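/- **Corollary 1.3.** Identify a plane (rooted, ordered) tree with its set of vertices in $\mathcal V=\bigcup_{n\ge 0}\{1,2,\dots\}^n$: a set $T\subseteq\mathcal V$ containing the root (the empty word $o$), and containing with each $(v_1,\dots,v_n)$, $n\ge1$, its parent $(v_1,\dots,v_{n-1})$ and, if $v_n\ge 2$, its older sibling $(v_1,\dots,v_{n-1},v_n-1)$. For $1\le k<\infty$ let $\mathcal T_k$ be the uniform distribution on the plane trees with exactly $k$ vertices. For $p\in(0,1]$ let $T(p)$ be the Galton–Watson tree whose offspring numbers $X_v$, $v\in\mathcal V$, are i.i.d. with $\mathbb P(X_v=n)=p^n(1-p)$ for $n=0,1,2,\dots$ (for $p=1$ this means $X_v=\infty$ almost surely, so $T(1)=\mathcal V$); the children of a vertex $v\in T(p)$ are $(v,i)$, $1\le i\le X_v$, $i<\infty$. For $1/2<p\le 1$ let $\mathcal T_\infty(p)$ be the law of $T(p)$ conditioned on $|T(p)|=\infty$. Let $\mathcal T_\infty(1/2)$ be the law of $\bigcup_{k\ge1}T_k$, where $(T_k)_{k\ge 1}$ is a coupling with $T_k\sim\mathcal T_k$ for all $k\ge 1$ and $T_1\subseteq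 T_2\subseteq\cdots$ almost surely; such a coupling exists, and the conclusion below holds whichever one is used. Then for every integer $k\ge1$ and every $p\in[1/2,1]$ there are random trees $T_k\sim\mathcal T_k$ and $T_\infty(p)\sim\mathcal T_\infty(p)$ on a common probability space such that $$\mathbb P\bigl(T_k\subseteq T_\infty(p)\bigr)=1 .$$ -/

import Mathlib

open MeasureTheory ProbabilityTheory Set
open scoped ENNReal

/-- Ulam–Harris vertices: finite words of child labels, the root being the empty word.
The children of `v` are `v ++ [0], v ++ [1], …` in order of birth (labels start at `0`, so that
`v ++ [i]` is the `(i + 1)`-st child of `v`). -/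
abbrev Vertex : Type := List ℕ

/-- A vertex set `t` is a plane (rooted, ordered) tree: it contains the root, the parent of each
of its non-root vertices, and the next older sibling of each of its vertices that has one.
A tree is identified with its vertex set; the σ-algebra on `Set Vertex` is Mathlib's product one,
generated by the events `{t | v ∈ t}`. -/
structure IsPlaneTree (t : Set Vertex) : Prop where
  root_mem : [] ∈ t
  parent_mem : ∀ (v : Vertex) (i : ℕ), v ++ [i] ∈ t → v ∈ t
  sibling_mem : ∀ (v : Vertex) (i : ℕ), v ++ [i + 1] ∈ t → v ++ [i] ∈ t

/-- The law of `T_k`: the uniform distribution on the plane trees with exactly `k` vertices. -/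
noncomputable def uniformTreeLaw (k : ℕ) : Measure (Set Vertex) :=
  uniformOn {t : Set Vertex | IsPlaneTree t ∧ t.encard = k}

/-- The geometric offspring law: mass `p ^ n * (1 - p)` at each finite `n`.  For `p = 1`
these masses vanish and the law is the point mass at `∞`. -/
noncomputable def geomLaw (p : ℝ) : Measure ℕ∞ :=
  Measure.sum (fun n : ℕ => ENNReal.ofReal (p ^ n * (1 - p)) • Measure.dirac (n : ℕ∞))
    + (if p = 1 then Measure.dirac ⊤ else 0)

/-- Generation `n` of the family tree in which `v` has `x v` children. -/
def gwGeneration (x : Vertex → ℕ∞) : ℕ → Set Vertex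
  | 0 => {[]}
  | n + 1 => {w | ∃ v ∈ gwGeneration x n, ∃ i : ℕ, (i : ℕ∞) < x v ∧ w = v ++ [i]}

/-- The family tree in which `v` has `x v` children. -/
def gwTree (x : Vertex → ℕ∞) : Set Vertex := ⋃ n, gwGeneration x n

/-- The law of the Galton–Watson tree `T(p)`: its offspring numbers are independent, all with
law `geomLaw p`. -/
noncomputable def gwLaw (p : ℝ) : Measure (Set Vertex) :=
  (Measure.infinitePi (fun _ : Vertex => geomLaw p)).map gwTree

/-- `μ` is the law of `⋃ k, T_k` for some coupling of uniform plane trees `T_k`, `k ≥ 1`, with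
`T_1 ⊆ T_2 ⊆ …` almost surely.  In the code `T n` is `T_{n+1}`. -/
def IsIncreasingUnionLaw (μ : Measure (Set Vertex)) : Prop :=
  ∃ (Ω : Type) (_ : MeasurableSpace Ω) (P : Measure Ω) (_ : IsProbabilityMeasure P)
    (T : ℕ → Ω → Set Vertex),
    (∀ n, HasLaw (T n) (uniformTreeLaw (n + 1)) P) ∧
    (∀ᵐ ω ∂P, ∀ n, T n ω ⊆ T (n + 1) ω) ∧
    HasLaw (fun ω => ⋃ n, T n ω) μ P

/-- `μ` is the law of `T_∞(p)`: for `p > 1/2`, the law of `T(p)` conditioned on being infinite;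
for `p = 1/2`, the law of the union of an increasing coupling of the uniform plane trees. -/
def IsInfiniteTreeLaw (p : ℝ) (μ : Measure (Set Vertex)) : Prop :=
  (p = 1 / 2 ∧ IsIncreasingUnionLaw μ) ∨
    (1 / 2 < p ∧ μ = (gwLaw p)[|{t : Set Vertex | t.Infinite}])

/-! Reading first children as left children and next siblings as right children turns plane trees
with n + 1 vertices into binary trees with n nodes, compatibly with inclusion of vertex sets
(`planeTree`). A uniform binary tree with n + 1 nodes gives a of its n non-root nodes to the left
with probability C_a C_{n-a} / C_{n+1}, and the two parts are then independent and uniform. Under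
the encoding T(p) becomes a percolation cluster, each available node being kept with probability p.
For p > 1/2 the infinite cluster splits in the same manner: left part of finite size a and right
part infinite with probability C_a (p(1-p))^{a+1}, the mirror image with the same probability, both
parts infinite with probability 2p - 1.

All these trees are built from one family of independent uniform labels (`splitTree`). A node with N
nodes in its subtree and label u cuts the cumulative sums of `splitWeight p N` at u for the left
size and at 1 - u for the right size. Since C_{n+1} / C_n increases in n and stays below 4, while
p(1-p) ≤ 1/4, each weight decreases as N grows (`splitWeight_anti`). Hence both sizes increase with
N, and so does the whole tree (`splitTree_mono`).

It remains to identify the laws. For finite N the tree is uniform (`hasLaw_splitTree`). For N = ⊤ a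
law of plane trees is determined by the probabilities of containing finite trees F; T(p) contains
`planeTree F` with probability p^n, n being the number of nodes of F. Subtracting the finite
clusters, which are mixtures of uniform trees, leaves the recursion of the infinite split tree
(`containProb_top_add_finiteContainProb`, `hasLaw_splitTree_top`). At p = 1/2 the inclusion is part
of the definition of the limit law, and the same coupling proves existence. -/

/-! ### Plane trees as binary trees. -/

/-- The descendants, in the binary encoding of plane trees, of the vertex `v ++ [i]`: this vertex,
its younger siblings, and all their descendants. -/
def branch (v : Vertex) (i : ℕ) : Set Vertex := {w | ∃ j, i ≤ j ∧ v ++ [j] <+: w}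

/-- The vertex set obtained by planting the binary tree at `v ++ [i]`: left children in the binary
tree become first children, right children become next siblings. -/
def place : Vertex → ℕ → BinaryTree Unit → Set Vertex
  | _, _, .nil => ∅
  | v, i, .node _ l r => insert (v ++ [i]) (place (v ++ [i]) 0 l ∪ place v (i + 1) r)

/-- The plane tree encoded by a binary tree. -/
def planeTree (F : BinaryTree Unit) : Set Vertex := insert [] (place [] 0 F)

lemma self_mem_branch (v : Vertex) (i : ℕ) : v ++ [i] ∈ branch v i :=
  ⟨i, le_rfl, List.prefix_rfl⟩

lemma branch_child_subset (v : Vertex) (i : ℕ) : branch (v ++ [i]) 0 ⊆ branch v i := by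
  rintro w ⟨j, -, hj⟩
  exact ⟨i, le_rfl, (List.prefix_append _ _).trans hj⟩

lemma branch_sibling_subset (v : Vertex) (i : ℕ) : branch v (i + 1) ⊆ branch v i := by
  rintro w ⟨j, hij, hj⟩
  exact ⟨j, by omega, hj⟩

/-- This is the recursion of the complete binary tree: a root, its left part and its right part.
Every induction on binary trees below follows it. -/
lemma branch_eq (v : Vertex) (i : ℕ) :
    branch v i = insert (v ++ [i]) (branch (v ++ [i]) 0 ∪ branch v (i + 1)) := by
  apply Subset.antisymm
  · rintro w ⟨j, hij, u, rfl⟩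
    rcases hij.eq_or_lt with rfl | h
    · cases u with
      | nil => simp
      | cons a u =>
        right; left
        exact ⟨a, Nat.zero_le _, u, by simp⟩
    · right; right
      exact ⟨j, h, u, rfl⟩
  · rintro w (rfl | h | h)
    · exact self_mem_branch v i
    · exact branch_child_subset v i h
    · exact branch_sibling_subset v i h

lemma self_notMem_branch_child (v : Vertex) (i : ℕ) : v ++ [i] ∉ branch (v ++ [i]) 0 := by
  rintro ⟨j, -, h⟩
  simpa using h.length_le

lemma self_notMem_branch_sibling (v : Vertex) (i : ℕ) : v ++ [i] ∉ branch v (i + 1) := by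
  rintro ⟨j, hj, h⟩
  have := h.eq_of_length (by simp)
  simp at this
  omega

lemma disjoint_branch (v : Vertex) (i : ℕ) : Disjoint (branch (v ++ [i]) 0) (branch v (i + 1)) := by
  rw [Set.disjoint_left]
  rintro w ⟨j, -, hj⟩ ⟨k, hk, hk'⟩
  have h1 : v ++ [i] <+: w := (List.prefix_append _ _).trans hj
  have h2 := (List.prefix_of_prefix_length_le h1 hk' (by simp)).eq_of_length (by simp)
  simp at h2
  omega

lemma mem_branch_root {w : Vertex} : w ∈ branch [] 0 ↔ w ≠ [] := by
  constructor
  · rintro ⟨j, -, h⟩ rfl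
    simp at h
  · intro h
    cases w with
    | nil => exact absurd rfl h
    | cons a w => exact ⟨a, Nat.zero_le _, w, rfl⟩

lemma notMem_branch (v : Vertex) (i : ℕ) : v ∉ branch v i := by
  rintro ⟨j, -, h⟩
  simpa using h.length_le

lemma place_subset_branch (F : BinaryTree Unit) (v : Vertex) (i : ℕ) : place v i F ⊆ branch v i := by
  induction F generalizing v i with
  | nil => simp [place]
  | node _ l r hl hr =>
    rw [branch_eq, place]
    exact insert_subset_insert (union_subset_union (hl _ _) (hr _ _))

lemma encard_place (F : BinaryTree Unit) (v : Vertex) (i : ℕ) :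
    (place v i F).encard = F.numNodes := by
  induction F generalizing v i with
  | nil => simp [place]
  | node _ l r hl hr =>
    rw [place, encard_insert_of_notMem, encard_union_eq, hl, hr]
    · simp [BinaryTree.numNodes]
    · exact (disjoint_branch v i).mono (place_subset_branch _ _ _) (place_subset_branch _ _ _)
    · rintro (h | h)
      · exact self_notMem_branch_child v i (place_subset_branch _ _ _ h)
      · exact self_notMem_branch_sibling v i (place_subset_branch _ _ _ h)

lemma encard_planeTree (F : BinaryTree Unit) : (planeTree F).encard = F.numNodes + 1 := by
  rw [planeTree, encard_insert_of_notMem, encard_place]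
  exact fun h => notMem_branch [] 0 (place_subset_branch _ _ _ h)

lemma finite_planeTree (F : BinaryTree Unit) : (planeTree F).Finite := by
  apply finite_of_encard_eq_coe (k := F.numNodes + 1)
  simp [encard_planeTree]

lemma place_node_inter_child (v : Vertex) (i : ℕ) (a : Unit) (l r : BinaryTree Unit) :
    place v i (.node a l r) ∩ branch (v ++ [i]) 0 = place (v ++ [i]) 0 l := by
  ext w
  have h1 := @place_subset_branch l (v ++ [i]) 0 w
  have h2 := @place_subset_branch r v (i + 1) w
  have h3 := self_notMem_branch_child v i
  have h4 : w ∈ branch (v ++ [i]) 0 → w ∉ branch v (i + 1) :=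
    fun h => Set.disjoint_left.1 (disjoint_branch v i) h
  simp only [place, mem_inter_iff, mem_insert_iff, mem_union]
  constructor
  · rintro ⟨rfl | h | h, h'⟩
    · exact absurd h' h3
    · exact h
    · exact absurd (h2 h) (h4 h')
  · exact fun h => ⟨.inr (.inl h), h1 h⟩

lemma place_node_inter_sibling (v : Vertex) (i : ℕ) (a : Unit) (l r : BinaryTree Unit) :
    place v i (.node a l r) ∩ branch v (i + 1) = place v (i + 1) r := by
  ext w
  have h1 := @place_subset_branch l (v ++ [i]) 0 w
  have h2 := @place_subset_branch r v (i + 1) w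
  have h3 := self_notMem_branch_sibling v i
  have h4 : w ∈ branch (v ++ [i]) 0 → w ∉ branch v (i + 1) :=
    fun h => Set.disjoint_left.1 (disjoint_branch v i) h
  simp only [place, mem_inter_iff, mem_insert_iff, mem_union]
  constructor
  · rintro ⟨rfl | h | h, h'⟩
    · exact absurd h' h3
    · exact absurd h' (h4 (h1 h))
    · exact h
  · exact fun h => ⟨.inr (.inr h), h2 h⟩

lemma place_injective (v : Vertex) (i : ℕ) : Function.Injective (place v i) := by
  intro F G h
  induction F generalizing v i G with
  | nil =>
    cases G with
    | nil => rfl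
    | node b l r => exact absurd h.symm (insert_nonempty _ _).ne_empty
  | node a l r hl hr =>
    cases G with
    | nil => exact absurd h (insert_nonempty _ _).ne_empty
    | node b l' r' =>
      have h1 := congrArg (· ∩ branch (v ++ [i]) 0) h
      have h2 := congrArg (· ∩ branch v (i + 1)) h
      simp only [place_node_inter_child, place_node_inter_sibling] at h1 h2
      rw [hl _ _ h1, hr _ _ h2]

lemma place_eq_planeTree_inter (F : BinaryTree Unit) :
    planeTree F ∩ branch [] 0 = place [] 0 F := by
  ext w
  have h1 := @place_subset_branch F [] 0 w
  rw [mem_branch_root] at h1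
  simp only [planeTree, mem_inter_iff, mem_insert_iff, mem_branch_root]
  tauto

lemma planeTree_injective : Function.Injective planeTree := by
  intro F G h
  apply place_injective [] 0
  rw [← place_eq_planeTree_inter, h, place_eq_planeTree_inter]

lemma parent_mem_place {F : BinaryTree Unit} {v : Vertex} {i : ℕ} {w : Vertex} {j : ℕ}
    (h : w ++ [j] ∈ place v i F) : w = v ∨ w ∈ place v i F := by
  induction F generalizing v i with
  | nil => simp [place] at h
  | node a l r hl hr =>
    rcases h with h | h | h
    · left; exact (List.append_inj_left' h rfl)
    · rcases hl h with h | h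
      · right; left; exact h
      · right; right; left; exact h
    · rcases hr h with h | h
      · left; exact h
      · right; right; right; exact h

lemma sibling_mem_place {F : BinaryTree Unit} {v : Vertex} {i : ℕ} {w : Vertex} {j : ℕ}
    (h : w ++ [j + 1] ∈ place v i F) : (w = v ∧ j + 1 = i) ∨ w ++ [j] ∈ place v i F := by
  induction F generalizing v i with
  | nil => simp [place] at h
  | node a l r hl hr =>
    rcases h with h | h | h
    · left
      have := List.append_inj' h rfl
      simpa using this
    · rcases hl h with h | h
      · omega
      · right; right; left; exact h
    · rcases hr h with h | h
      -- The right part starts at `v ++ [i + 1]`, whose older sibling is the root `v ++ [i]` of the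
      -- whole.
      · right; left; rw [h.1]; congr 2; omega
      · right; right; right; exact h

lemma isPlaneTree_planeTree (F : BinaryTree Unit) : IsPlaneTree (planeTree F) where
  root_mem := mem_insert _ _
  parent_mem v i h := by
    rcases h with h | h
    · simp at h
    · exact parent_mem_place h
  sibling_mem v i h := by
    rcases h with h | h
    · simp at h
    · rcases sibling_mem_place h with h | h
      · omega
      · exact .inr h

namespace IsPlaneTree

variable {t : Set Vertex}

lemma mem_of_prefix (ht : IsPlaneTree t) {v w : Vertex} (h : v <+: w) (hw : w ∈ t) : v ∈ t := by
  obtain ⟨u, rfl⟩ := h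
  induction u using List.reverseRecOn with
  | nil => simpa using hw
  | append_singleton u a ih => exact ih (ht.parent_mem _ a (by simpa using hw))

lemma sibling_mem_of_le (ht : IsPlaneTree t) {v : Vertex} {i j : ℕ} (hij : i ≤ j)
    (h : v ++ [j] ∈ t) : v ++ [i] ∈ t := by
  induction j, hij using Nat.le_induction with
  | base => exact h
  | succ j _ ih => exact ih (ht.sibling_mem _ _ h)

lemma inter_branch_eq_empty (ht : IsPlaneTree t) {v : Vertex} {i : ℕ} (h : v ++ [i] ∉ t) :
    t ∩ branch v i = ∅ := by
  rw [Set.eq_empty_iff_forall_notMem]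
  rintro w ⟨hw, j, hij, hj⟩
  exact h (ht.sibling_mem_of_le hij (ht.mem_of_prefix hj hw))

lemma inter_branch_eq {v : Vertex} {i : ℕ} (h : v ++ [i] ∈ t) :
    t ∩ branch v i = insert (v ++ [i]) (t ∩ branch (v ++ [i]) 0 ∪ t ∩ branch v (i + 1)) := by
  rw [branch_eq, inter_insert_of_mem h, inter_union_distrib_left]

/-- Strong induction on cardinality: deleting `v ++ [i]` leaves a child part and a sibling part,
both strictly smaller. -/
lemma exists_place_eq (ht : IsPlaneTree t) {v : Vertex} {i : ℕ} (hfin : (t ∩ branch v i).Finite) :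
    ∃ F, t ∩ branch v i = place v i F := by
  induction hn : (t ∩ branch v i).ncard using Nat.strong_induction_on generalizing v i with
  | _ n ih =>
    by_cases hv : v ++ [i] ∈ t
    · have hl : t ∩ branch (v ++ [i]) 0 ⊂ t ∩ branch v i :=
        ssubset_iff_subset_ne.2 ⟨inter_subset_inter_right _ (branch_child_subset v i), fun h =>
          self_notMem_branch_child v i (h.symm.subset ⟨hv, self_mem_branch v i⟩).2⟩
      have hr : t ∩ branch v (i + 1) ⊂ t ∩ branch v i :=
        ssubset_iff_subset_ne.2 ⟨inter_subset_inter_right _ (branch_sibling_subset v i), fun h =>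
          self_notMem_branch_sibling v i (h.symm.subset ⟨hv, self_mem_branch v i⟩).2⟩
      obtain ⟨l, hl⟩ := ih _ (hn ▸ ncard_lt_ncard hl hfin) (hfin.subset hl.subset) rfl
      obtain ⟨r, hr⟩ := ih _ (hn ▸ ncard_lt_ncard hr hfin) (hfin.subset hr.subset) rfl
      exact ⟨.node () l r, by rw [inter_branch_eq hv, hl, hr, place]⟩
    · exact ⟨.nil, ht.inter_branch_eq_empty hv⟩

lemma eq_insert_root (ht : IsPlaneTree t) : t = insert [] (t ∩ branch [] 0) := by
  ext w
  by_cases h : w = []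
  · simp [h, ht.root_mem]
  · simp [h, mem_branch_root]

lemma exists_eq_planeTree (ht : IsPlaneTree t) (hfin : t.Finite) : ∃ F, t = planeTree F := by
  obtain ⟨F, hF⟩ := ht.exists_place_eq (v := []) (i := 0) (hfin.subset inter_subset_left)
  exact ⟨F, by rw [ht.eq_insert_root, hF, planeTree]⟩

end IsPlaneTree

/-- Any finite set of vertices generates a finite plane tree. -/
lemma exists_planeTree_hull (A : Finset Vertex) :
    ∃ F, ∀ t, IsPlaneTree t → (↑A ⊆ t ↔ planeTree F ⊆ t) := by
  obtain ⟨d, hd⟩ : ∃ d : ℕ, ∀ v ∈ A, v.length ≤ d :=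
    ⟨A.sup List.length, fun v hv => Finset.le_sup (f := List.length) hv⟩
  obtain ⟨M, hM⟩ : ∃ M : ℕ, ∀ v ∈ A, ∀ i ∈ v, i < M := by
    refine ⟨(A.biUnion List.toFinset).sup id + 1, fun v hv i hi => Nat.lt_succ_of_le ?_⟩
    exact Finset.le_sup (f := id) (Finset.mem_biUnion.2 ⟨v, hv, by simpa using hi⟩)
  -- Bounded length and bounded labels give a finite plane tree containing `A`, so the intersection
  -- `H` of all plane trees containing `A` is finite.
  let B : Set Vertex := {v | v.length ≤ d ∧ ∀ i ∈ v, i < M}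
  have hB : IsPlaneTree B := by
    refine ⟨by simp [B], fun v i h => ⟨?_, fun j hj => h.2 j (by simp [hj])⟩, fun v i h => ⟨?_, ?_⟩⟩
    · have := h.1; simp at this; omega
    · simpa using h.1
    · intro j hj
      rcases List.mem_append.1 hj with hj | hj
      · exact h.2 j (by simp [hj])
      · have := h.2 (i + 1) (by simp)
        simp at hj
        omega
  have hBfin : B.Finite := by
    refine ((List.finite_length_le (Fin M) d).image (List.map Fin.val)).subset ?_
    rintro v ⟨h1, h2⟩
    lift v to List (Fin M) using fun i hi => h2 i hi
    exact ⟨v, by simpa using h1, rfl⟩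
  let H : Set Vertex := ⋂₀ {t | IsPlaneTree t ∧ ↑A ⊆ t}
  have hH : IsPlaneTree H :=
    ⟨fun t ht => ht.1.root_mem, fun v i h t ht => ht.1.parent_mem v i (h t ht),
      fun v i h t ht => ht.1.sibling_mem v i (h t ht)⟩
  have hHB : H ⊆ B := sInter_subset_of_mem ⟨hB, fun v hv => ⟨hd v hv, hM v hv⟩⟩
  obtain ⟨F, hF⟩ := hH.exists_eq_planeTree (hBfin.subset hHB)
  refine ⟨F, fun t ht => ⟨fun h => hF ▸ sInter_subset_of_mem ⟨ht, h⟩, fun h => ?_⟩⟩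
  exact (subset_sInter fun s hs => hs.2).trans ((hF ▸ h : H ⊆ t))

/-! ### Catalan numbers: ratios and generating function. -/

lemma catalan_pos (n : ℕ) : 0 < catalan n := by
  have h := succ_mul_catalan_eq_centralBinom n
  have := Nat.centralBinom_pos n
  by_contra h0
  have h0 : catalan n = 0 := by omega
  simp [h0] at h
  omega

lemma cast_catalan_pos (n : ℕ) : (0 : ℝ) < catalan n := Nat.cast_pos.2 (catalan_pos n)

lemma catalan_succ_eq_mul (n : ℕ) :
    (catalan (n + 1) : ℝ) = (4 * n + 2) / (n + 2) * catalan n := by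
  have h1 : ((n : ℝ) + 1) * catalan n = n.centralBinom :=
    mod_cast succ_mul_catalan_eq_centralBinom n
  have h2 : ((n : ℝ) + 1 + 1) * catalan (n + 1) = (n + 1).centralBinom :=
    mod_cast succ_mul_catalan_eq_centralBinom (n + 1)
  have h3 : ((n : ℝ) + 1) * (n + 1).centralBinom = 2 * (2 * n + 1) * n.centralBinom :=
    mod_cast Nat.succ_mul_centralBinom_succ n
  rw [← h1, ← h2] at h3
  have : (n : ℝ) + 1 ≠ 0 := by positivity
  have : (n : ℝ) + 2 ≠ 0 := by positivity
  field_simp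
  apply mul_left_cancel₀ (a := (n : ℝ) + 1) (by positivity)
  linarith

/-- Log-convexity: the ratio C_{n+1} / C_n = (4n + 2) / (n + 2) increases with n. -/
lemma catalan_succ_mul_le {m n : ℕ} (h : m ≤ n) :
    (catalan (m + 1) : ℝ) * catalan n ≤ catalan (n + 1) * catalan m := by
  have hmn : (m : ℝ) ≤ n := mod_cast h
  have key : (4 * (m : ℝ) + 2) / (m + 2) ≤ (4 * n + 2) / (n + 2) := by
    rw [div_le_div_iff₀ (by positivity) (by positivity)]
    nlinarith
  rw [catalan_succ_eq_mul, catalan_succ_eq_mul]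
  have := mul_le_mul_of_nonneg_right key (by positivity : (0 : ℝ) ≤ catalan m * catalan n)
  linarith

lemma catalan_succ_le_four_mul (n : ℕ) : (catalan (n + 1) : ℝ) ≤ 4 * catalan n := by
  rw [catalan_succ_eq_mul]
  gcongr
  rw [div_le_iff₀ (by positivity)]
  linarith

lemma catalan_add_le (n k : ℕ) : (catalan (n + k) : ℝ) ≤ 4 ^ k * catalan n := by
  induction k with
  | zero => simp
  | succ k ih =>
    calc (catalan (n + (k + 1)) : ℝ) ≤ 4 * catalan (n + k) := catalan_succ_le_four_mul (n + k)
      _ ≤ 4 * (4 ^ k * catalan n) := by gcongr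
      _ = _ := by ring

lemma sum_antidiagonal_le_sq {a : ℕ → ℝ} (ha : ∀ n, 0 ≤ a n) (N : ℕ) :
    ∑ m ∈ Finset.range N, ∑ ij ∈ Finset.HasAntidiagonal.antidiagonal m, a ij.1 * a ij.2 ≤
      (∑ m ∈ Finset.range N, a m) ^ 2 := by
  rw [sq, Finset.sum_mul_sum, ← Finset.sum_product', ← Finset.sum_biUnion]
  · refine Finset.sum_le_sum_of_subset_of_nonneg ?_ fun _ _ _ => mul_nonneg (ha _) (ha _)
    intro x hx
    simp only [Finset.mem_biUnion, Finset.mem_range, Finset.HasAntidiagonal.mem_antidiagonal] at hx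
    simp only [Finset.mem_product, Finset.mem_range]
    omega
  · intro m _ m' _ hmm
    rw [Function.onFun, Finset.disjoint_left]
    intro x hx hx'
    rw [Finset.HasAntidiagonal.mem_antidiagonal] at hx hx'
    omega

/-- The generating function of the Catalan numbers at `p * (1 - p)`. -/
lemma hasSum_catalan {p : ℝ} (hp : 1 / 2 < p) (hp1 : p ≤ 1) :
    HasSum (fun m : ℕ => (catalan m : ℝ) * (p * (1 - p)) ^ m) (1 / p) := by
  set x := p * (1 - p) with hx
  have hp0 : 0 < p := by linarith
  have hx0 : 0 ≤ x := mul_nonneg hp0.le (by linarith)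
  set a : ℕ → ℝ := fun m => (catalan m : ℝ) * x ^ m with ha
  have ha0 : ∀ m, 0 ≤ a m := fun m => by positivity
  have hsucc : ∀ m, a (m + 1) = x * ∑ ij ∈ Finset.HasAntidiagonal.antidiagonal m, a ij.1 * a ij.2 := by
    intro m
    simp only [ha, catalan_succ', Nat.cast_sum, Finset.sum_mul, Finset.mul_sum]
    refine Finset.sum_congr rfl fun ij hij => ?_
    rw [← Finset.HasAntidiagonal.mem_antidiagonal.1 hij]
    push_cast
    ring
  -- By the Catalan recursion the partial sums satisfy S_{N+1} ≤ 1 + x S_N², and 1/p is a fixed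
  -- point of S ↦ 1 + x S².
  have hbound : ∀ N, ∑ m ∈ Finset.range N, a m ≤ 1 / p := by
    intro N
    induction N with
    | zero => simp; positivity
    | succ N ih =>
      rw [Finset.sum_range_succ']
      simp only [hsucc, ← Finset.mul_sum]
      have h1 := sum_antidiagonal_le_sq ha0 N
      have h2 : (∑ m ∈ Finset.range N, a m) ^ 2 ≤ (1 / p) ^ 2 := by
        gcongr
      have h3 := mul_le_mul_of_nonneg_left (h1.trans h2) hx0
      have h4 : x * (1 / p) ^ 2 + 1 = 1 / p := by rw [hx]; field_simp; ring
      have h5 : a 0 = 1 := by simp [ha]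
      linarith
  have hsum : Summable a := summable_of_sum_range_le ha0 hbound
  have hle : ∑' m, a m ≤ 1 / p := hsum.tsum_le_of_sum_range_le hbound
  have heq : ∑' m, a m = 1 + x * (∑' m, a m) ^ 2 := by
    conv_lhs => rw [hsum.tsum_eq_zero_add]
    simp only [hsucc]
    rw [tsum_mul_left, sq, tsum_mul_tsum_eq_tsum_sum_antidiagonal_of_summable_norm hsum.norm hsum.norm]
    simp [ha]
  set S := ∑' m, a m
  rw [le_div_iff₀ hp0] at hle
  -- The equation S = 1 + x S² factors. The root 1/(1-p), present only for p < 1, exceeds the bound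
  -- 1/p because p > 1/2.
  have h6 : (p * S - 1) * ((1 - p) * S - 1) = 0 := by rw [hx] at heq; linarith
  have h7 : S = 1 / p := by
    rcases mul_eq_zero.1 h6 with h | h
    · field_simp; linarith
    · nlinarith
  exact h7 ▸ hsum.hasSum

/-! ### The splitting weights and their monotonicity in the size. -/

/-- The probability that the left subtree gets `i` nodes, in a tree with `N` nodes, uniform if `N`
is finite and the percolation cluster with parameter `p` conditioned to be infinite if `N = ⊤`. -/
noncomputable def splitWeight (p : ℝ) (N : ℕ∞) (i : ℕ) : ℝ :=
  if N = ⊤ then catalan i * (p * (1 - p)) ^ (i + 1)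
  else catalan i * catalan (N.toNat - 1 - i) / catalan N.toNat

lemma splitWeight_top (p : ℝ) (i : ℕ) :
    splitWeight p ⊤ i = catalan i * (p * (1 - p)) ^ (i + 1) := by simp [splitWeight]

lemma splitWeight_coe (p : ℝ) (n i : ℕ) :
    splitWeight p n i = catalan i * catalan (n - 1 - i) / catalan n := by simp [splitWeight]

lemma splitWeight_nonneg {p : ℝ} (hp : 0 ≤ p) (hp1 : p ≤ 1) (N : ℕ∞) (i : ℕ) :
    0 ≤ splitWeight p N i := by
  have : 0 ≤ p * (1 - p) := mul_nonneg hp (by linarith)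
  unfold splitWeight
  split_ifs <;> positivity

lemma splitWeight_succ_le (p : ℝ) {n i : ℕ} (h : i < n) :
    splitWeight p (n + 1 : ℕ) i ≤ splitWeight p n i := by
  obtain ⟨m, rfl⟩ := Nat.exists_eq_add_of_lt h
  rw [splitWeight_coe, splitWeight_coe, show i + m + 1 + 1 - 1 - i = m + 1 by omega,
    show i + m + 1 - 1 - i = m by omega,
    div_le_div_iff₀ (cast_catalan_pos _) (cast_catalan_pos _)]
  have := catalan_succ_mul_le (show m ≤ i + m + 1 by omega)
  have := mul_le_mul_of_nonneg_left this (cast_catalan_pos i).le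
  linarith

/-- With m = n - 1 - i the claim is (p(1-p))^{i+1} C_{m+i+1} ≤ C_m, which follows from p(1-p) ≤ 1/4
and the growth factor at most 4 of the Catalan numbers. -/
lemma splitWeight_top_le {p : ℝ} (hp : 0 ≤ p) (hp1 : p ≤ 1) {n i : ℕ} (h : i < n) :
    splitWeight p ⊤ i ≤ splitWeight p n i := by
  obtain ⟨m, rfl⟩ := Nat.exists_eq_add_of_lt h
  have hx : 0 ≤ p * (1 - p) := mul_nonneg hp (by linarith)
  have hx4 : p * (1 - p) ≤ 1 / 4 := by nlinarith [sq_nonneg (p - 1 / 2)]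
  rw [splitWeight_coe, splitWeight_top, show i + m + 1 - 1 - i = m by omega, mul_div_assoc]
  gcongr
  rw [le_div_iff₀ (cast_catalan_pos _)]
  calc (p * (1 - p)) ^ (i + 1) * (catalan (i + m + 1) : ℝ)
      ≤ (1 / 4) ^ (i + 1) * (4 ^ (i + 1) * catalan m) := by
        gcongr
        rw [show i + m + 1 = m + (i + 1) by omega]
        exact catalan_add_le m (i + 1)
    _ = catalan m := by rw [← mul_assoc, ← mul_pow]; simp

lemma splitWeight_anti {p : ℝ} (hp : 0 ≤ p) (hp1 : p ≤ 1) {N M : ℕ∞} (h : N ≤ M) {i : ℕ}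
    (hi : (i : ℕ∞) < N) : splitWeight p M i ≤ splitWeight p N i := by
  induction N with
  | top => rw [top_le_iff.1 h]
  | coe n =>
    have hi : i < n := mod_cast hi
    induction M with
    | top => exact splitWeight_top_le hp hp1 hi
    | coe m =>
      have h : n ≤ m := mod_cast h
      induction m, h using Nat.le_induction with
      | base => rfl
      | succ m hm ih =>
        exact (splitWeight_succ_le p (by omega)).trans (ih (mod_cast hm))

/-- The cumulative sums of `splitWeight`. -/
noncomputable def splitCumul (p : ℝ) (N : ℕ∞) (j : ℕ) : ℝ :=
  ∑ i ∈ Finset.range j, splitWeight p N i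

@[simp] lemma splitCumul_zero (p : ℝ) (N : ℕ∞) : splitCumul p N 0 = 0 := by simp [splitCumul]

lemma splitCumul_succ (p : ℝ) (N : ℕ∞) (j : ℕ) :
    splitCumul p N (j + 1) = splitCumul p N j + splitWeight p N j := Finset.sum_range_succ _ _

lemma splitCumul_mono {p : ℝ} (hp : 0 ≤ p) (hp1 : p ≤ 1) (N : ℕ∞) :
    Monotone (splitCumul p N) :=
  monotone_nat_of_le_succ fun j => by
    rw [splitCumul_succ]
    linarith [splitWeight_nonneg hp hp1 N j]

/-- The bound on `j` keeps the indices below `N`; beyond it truncated subtraction makes the weights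
meaningless. -/
lemma splitCumul_anti {p : ℝ} (hp : 0 ≤ p) (hp1 : p ≤ 1) {N M : ℕ∞} (h : N ≤ M) {j : ℕ}
    (hj : (j : ℕ∞) ≤ N) : splitCumul p M j ≤ splitCumul p N j :=
  Finset.sum_le_sum fun i hi => splitWeight_anti hp hp1 h
    (lt_of_lt_of_le (by exact_mod_cast Finset.mem_range.1 hi) hj)

lemma splitCumul_self (p : ℝ) (n : ℕ) : splitCumul p (n + 1 : ℕ) (n + 1) = 1 := by
  simp only [splitCumul, splitWeight_coe]
  rw [← Finset.sum_div, div_eq_one_iff_eq (cast_catalan_pos _).ne', catalan_succ',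
    Finset.Nat.sum_antidiagonal_eq_sum_range_succ (fun x y => catalan x * catalan y)]
  push_cast
  exact Finset.sum_congr rfl fun i _ => by simp

/-- The weights are invariant under i ↦ n - i. This makes the right size, read off from 1 - u,
complementary to the left one. -/
lemma splitCumul_reflect (p : ℝ) (n j : ℕ) (hj : j ≤ n + 1) :
    splitCumul p (n + 1 : ℕ) (n + 1 - j) = 1 - splitCumul p (n + 1 : ℕ) j := by
  have h := Finset.sum_range_add_sum_Ico (splitWeight p (n + 1 : ℕ)) hj
  have h2 : ∑ i ∈ Finset.Ico j (n + 1), splitWeight p (n + 1 : ℕ) i =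
      splitCumul p (n + 1 : ℕ) (n + 1 - j) := by
    have h4 := Finset.sum_Ico_reflect (splitWeight p (n + 1 : ℕ)) 0
      (show n + 1 - j ≤ n + 1 by omega)
    rw [show n + 1 - (n + 1 - j) = j by omega, Nat.sub_zero] at h4
    rw [splitCumul, Finset.range_eq_Ico, ← h4]
    refine Finset.sum_congr rfl fun i hi => ?_
    have := Finset.mem_Ico.1 hi
    rw [splitWeight_coe, splitWeight_coe, Nat.add_sub_cancel, show n - (n - i) = i by omega,
      mul_comm (catalan i : ℝ)]
  have h3 := splitCumul_self p n
  simp only [splitCumul] at *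
  linarith

lemma hasSum_splitWeight_top {p : ℝ} (hp : 1 / 2 < p) (hp1 : p ≤ 1) :
    HasSum (splitWeight p ⊤) (1 - p) := by
  have h := (hasSum_catalan hp hp1).mul_left (p * (1 - p))
  have h1 : p * (1 - p) * (1 / p) = 1 - p := by
    have : p ≠ 0 := by linarith
    field_simp
  rw [h1] at h
  have h2 : splitWeight p ⊤ = fun i => p * (1 - p) * ((catalan i : ℝ) * (p * (1 - p)) ^ i) := by
    funext i
    rw [splitWeight_top, pow_succ]
    ring
  exact h2 ▸ h

lemma splitCumul_top_le {p : ℝ} (hp : 1 / 2 < p) (hp1 : p ≤ 1) (j : ℕ) :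
    splitCumul p ⊤ j ≤ 1 - p :=
  sum_le_hasSum _ (fun i _ => splitWeight_nonneg (by linarith) hp1 _ i)
    (hasSum_splitWeight_top hp hp1)

/-! ### Left and right sizes as functions of a uniform label. -/

/-- The number of nodes passed on to the left subtree, by a node whose subtree has `N` nodes and
whose label is `u`. -/
noncomputable def leftSize (p : ℝ) (N : ℕ∞) (u : ℝ) : ℕ∞ :=
  {j : ℕ | (j : ℕ∞) + 1 < N ∧ splitCumul p N (j + 1) ≤ u}.encard

/-- The number of nodes passed on to the right subtree, by a node whose subtree has `N` nodes and
whose label is `u`. -/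
noncomputable def rightSize (p : ℝ) (N : ℕ∞) (u : ℝ) : ℕ∞ :=
  {j : ℕ | (j : ℕ∞) + 1 < N ∧ splitCumul p N (j + 1) < 1 - u}.encard

@[simp] lemma leftSize_zero (p u : ℝ) : leftSize p 0 u = 0 := by simp [leftSize]

@[simp] lemma rightSize_zero (p u : ℝ) : rightSize p 0 u = 0 := by simp [rightSize]

/-- As `N` grows the cumulative sums fall and the cutoff `j + 1 < N` loosens, so more indices are
counted. -/
lemma leftSize_mono {p : ℝ} (hp : 0 ≤ p) (hp1 : p ≤ 1) {N M : ℕ∞} (h : N ≤ M) (u : ℝ) :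
    leftSize p N u ≤ leftSize p M u :=
  encard_le_encard fun _ hj => ⟨hj.1.trans_le h,
    (splitCumul_anti hp hp1 h (by push_cast; exact hj.1.le)).trans hj.2⟩

lemma rightSize_mono {p : ℝ} (hp : 0 ≤ p) (hp1 : p ≤ 1) {N M : ℕ∞} (h : N ≤ M) (u : ℝ) :
    rightSize p N u ≤ rightSize p M u :=
  encard_le_encard fun _ hj => ⟨hj.1.trans_le h,
    (splitCumul_anti hp hp1 h (by push_cast; exact hj.1.le)).trans_lt hj.2⟩

lemma encard_Iio_nat (a : ℕ) : (Iio a).encard = a := by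
  rw [← Finset.coe_range, encard_coe_eq_coe_finsetCard, Finset.card_range]

lemma leftSize_coe {p : ℝ} (hp : 0 ≤ p) (hp1 : p ≤ 1) {n a : ℕ} {u : ℝ} (ha : a ≤ n)
    (hu : u ∈ Ico (splitCumul p (n + 1 : ℕ) a) (splitCumul p (n + 1 : ℕ) (a + 1))) :
    leftSize p (n + 1 : ℕ) u = a := by
  have hm := splitCumul_mono hp hp1 (n + 1 : ℕ)
  rw [leftSize, ← encard_Iio_nat a]
  refine congrArg Set.encard (Set.ext fun j => ?_)
  simp only [mem_ofPred_eq, mem_Iio]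
  constructor
  · rintro ⟨-, h⟩
    by_contra hj
    have := hm (show a + 1 ≤ j + 1 by omega)
    linarith [hu.2]
  · intro h
    exact ⟨by exact_mod_cast (by omega : j + 1 < n + 1), (hm (show j + 1 ≤ a by omega)).trans hu.1⟩

lemma rightSize_coe {p : ℝ} (hp : 0 ≤ p) (hp1 : p ≤ 1) {n a : ℕ} {u : ℝ} (ha : a ≤ n)
    (hu : u ∈ Ico (splitCumul p (n + 1 : ℕ) a) (splitCumul p (n + 1 : ℕ) (a + 1))) :
    rightSize p (n + 1 : ℕ) u = (n - a : ℕ) := by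
  have hm := splitCumul_mono hp hp1 (n + 1 : ℕ)
  rw [rightSize, ← encard_Iio_nat (n - a)]
  refine congrArg Set.encard (Set.ext fun j => ?_)
  simp only [mem_ofPred_eq, mem_Iio]
  constructor
  · rintro ⟨h0, h⟩
    have h0 : j + 1 < n + 1 := by exact_mod_cast h0
    by_contra hj
    -- After reflection the strict inequality at 1 - u becomes u < `splitCumul` at n - j, so j is
    -- counted exactly when a < n - j.
    have h1 := splitCumul_reflect p n (j + 1) (by omega)
    have := hm (show n + 1 - (j + 1) ≤ a by omega)
    linarith [hu.1]
  · intro h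
    have h1 := splitCumul_reflect p n (j + 1) (by omega)
    have := hm (show a + 1 ≤ n + 1 - (j + 1) by omega)
    exact ⟨by exact_mod_cast (by omega : j + 1 < n + 1), by linarith [hu.2]⟩

lemma exists_mem_Ico_splitCumul (p : ℝ) (n : ℕ) {u : ℝ} (hu : u ∈ Ico (0 : ℝ) 1) :
    ∃ a ≤ n, u ∈ Ico (splitCumul p (n + 1 : ℕ) a) (splitCumul p (n + 1 : ℕ) (a + 1)) := by
  classical
  have hex : ∃ a, u < splitCumul p (n + 1 : ℕ) (a + 1) := ⟨n, by rw [splitCumul_self]; exact hu.2⟩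
  refine ⟨Nat.find hex, Nat.find_min' hex (by rw [splitCumul_self]; exact hu.2), ?_,
    Nat.find_spec hex⟩
  rcases h : Nat.find hex with _ | b
  · simpa using hu.1
  · exact not_lt.1 (Nat.find_min hex (m := b) (by omega))

lemma leftSize_add_rightSize {p : ℝ} (hp : 0 ≤ p) (hp1 : p ≤ 1) (n : ℕ) {u : ℝ}
    (hu : u ∈ Ico (0 : ℝ) 1) :
    ∃ a ≤ n, leftSize p (n + 1 : ℕ) u = a ∧ rightSize p (n + 1 : ℕ) u = (n - a : ℕ) := by
  obtain ⟨a, ha, h⟩ := exists_mem_Ico_splitCumul p n hu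
  exact ⟨a, ha, leftSize_coe hp hp1 ha h, rightSize_coe hp hp1 ha h⟩

lemma coe_add_one_lt_top (j : ℕ) : (j : ℕ∞) + 1 < ⊤ := by
  exact_mod_cast ENat.natCast_lt_top (j + 1)

lemma leftSize_top {p : ℝ} (hp : 0 ≤ p) (hp1 : p ≤ 1) {a : ℕ} {u : ℝ}
    (hu : u ∈ Ico (splitCumul p ⊤ a) (splitCumul p ⊤ (a + 1))) : leftSize p ⊤ u = a := by
  have hm := splitCumul_mono hp hp1 ⊤
  rw [leftSize, ← encard_Iio_nat a]
  refine congrArg Set.encard (Set.ext fun j => ?_)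
  simp only [mem_ofPred_eq, mem_Iio, coe_add_one_lt_top, true_and]
  refine ⟨fun h => ?_, fun h => (hm (show j + 1 ≤ a by omega)).trans hu.1⟩
  by_contra hj
  have := hm (show a + 1 ≤ j + 1 by omega)
  linarith [hu.2]

lemma rightSize_top {p : ℝ} (hp : 0 ≤ p) (hp1 : p ≤ 1) {a : ℕ} {u : ℝ}
    (hu : 1 - u ∈ Ioc (splitCumul p ⊤ a) (splitCumul p ⊤ (a + 1))) : rightSize p ⊤ u = a := by
  have hm := splitCumul_mono hp hp1 ⊤
  rw [rightSize, ← encard_Iio_nat a]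
  refine congrArg Set.encard (Set.ext fun j => ?_)
  simp only [mem_ofPred_eq, mem_Iio, coe_add_one_lt_top, true_and]
  refine ⟨fun h => ?_, fun h => (hm (show j + 1 ≤ a by omega)).trans_lt hu.1⟩
  by_contra hj
  have := hm (show a + 1 ≤ j + 1 by omega)
  linarith [hu.2]

lemma leftSize_top_of_le {p : ℝ} (hp : 1 / 2 < p) (hp1 : p ≤ 1) {u : ℝ} (hu : 1 - p ≤ u) :
    leftSize p ⊤ u = ⊤ := by
  rw [leftSize, encard_eq_top_iff]
  convert infinite_univ (α := ℕ)
  rw [eq_univ_iff_forall]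
  exact fun j => ⟨coe_add_one_lt_top j, (splitCumul_top_le hp hp1 _).trans hu⟩

lemma rightSize_top_of_lt {p : ℝ} (hp : 1 / 2 < p) (hp1 : p ≤ 1) {u : ℝ} (hu : u < p) :
    rightSize p ⊤ u = ⊤ := by
  rw [rightSize, encard_eq_top_iff]
  convert infinite_univ (α := ℕ)
  rw [eq_univ_iff_forall]
  exact fun j => ⟨coe_add_one_lt_top j, (splitCumul_top_le hp hp1 _).trans_lt (by linarith)⟩

lemma measurable_leftSize (p : ℝ) (N : ℕ∞) : Measurable (leftSize p N) := by
  have : Monotone (leftSize p N) := fun u v huv =>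
    encard_le_encard fun _ hj => ⟨hj.1, hj.2.trans huv⟩
  exact measurable_to_countable' fun x => (ordConnected_singleton.preimage_mono this).measurableSet

lemma measurable_rightSize (p : ℝ) (N : ℕ∞) : Measurable (rightSize p N) := by
  have : Antitone (rightSize p N) := fun u v huv =>
    encard_le_encard fun _ hj => ⟨hj.1, hj.2.trans_le (by linarith)⟩
  exact measurable_to_countable' fun x => (ordConnected_singleton.preimage_anti this).measurableSet

/-! ### Integration over the label of one node. -/

/-- The uniform distribution on `[0, 1)`. -/
noncomputable def unitUniform : Measure ℝ := volume.restrict (Ico 0 1)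

instance : IsProbabilityMeasure unitUniform := ⟨by simp [unitUniform]⟩

lemma setLIntegral_split {f : ℕ∞ → ℕ∞ → ℝ≥0∞} {p : ℝ} {N A B : ℕ∞} {s : Set ℝ}
    (hs : MeasurableSet s) (h : ∀ u ∈ s, leftSize p N u = A ∧ rightSize p N u = B) :
    ∫⁻ u in s, f (leftSize p N u) (rightSize p N u) = volume s * f A B := by
  rw [setLIntegral_congr_fun (g := fun _ => f A B) hs fun u hu => by simp only [(h u hu).1, (h u hu).2],
    setLIntegral_const, mul_comm]

lemma lintegral_split_coe {p : ℝ} (hp : 0 ≤ p) (hp1 : p ≤ 1) (n : ℕ) (f : ℕ∞ → ℕ∞ → ℝ≥0∞) :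
    ∫⁻ u, f (leftSize p (n + 1 : ℕ) u) (rightSize p (n + 1 : ℕ) u) ∂unitUniform =
      ∑ a ∈ Finset.range (n + 1),
        ENNReal.ofReal (splitWeight p (n + 1 : ℕ) a) * f a (n - a : ℕ) := by
  have hm := splitCumul_mono hp hp1 (n + 1 : ℕ)
  have key : ∀ m ≤ n + 1, ∫⁻ u in Ico 0 (splitCumul p (n + 1 : ℕ) m),
      f (leftSize p (n + 1 : ℕ) u) (rightSize p (n + 1 : ℕ) u) =
      ∑ a ∈ Finset.range m, ENNReal.ofReal (splitWeight p (n + 1 : ℕ) a) * f a (n - a : ℕ) := by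
    intro m hmn
    induction m with
    | zero => simp
    | succ m ih =>
      have h0 := hm (Nat.zero_le m)
      rw [splitCumul_zero] at h0
      rw [← Ico_union_Ico_eq_Ico h0 (hm (Nat.le_succ m)), lintegral_union measurableSet_Ico
        (by rw [Set.disjoint_left]; intro x hx hx'; exact absurd hx.2 (not_lt.2 hx'.1)),
        ih (by omega), Finset.sum_range_succ,
        setLIntegral_split measurableSet_Ico fun u hu =>
          ⟨leftSize_coe hp hp1 (by omega : m ≤ n) hu, rightSize_coe hp hp1 (by omega : m ≤ n) hu⟩,
        Real.volume_Ico, splitCumul_succ, add_sub_cancel_left]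
  rw [unitUniform, ← key (n + 1) le_rfl, splitCumul_self]

lemma iUnion_Ico_splitCumul_top {p : ℝ} (hp : 1 / 2 < p) (hp1 : p ≤ 1) :
    ⋃ a : ℕ, Ico (splitCumul p ⊤ a) (splitCumul p ⊤ (a + 1)) = Ico 0 (1 - p) := by
  have hm := splitCumul_mono (by linarith) hp1 ⊤
  ext u
  simp only [mem_iUnion]
  constructor
  · rintro ⟨a, h1, h2⟩
    have := hm (Nat.zero_le a)
    rw [splitCumul_zero] at this
    exact ⟨this.trans h1, h2.trans_le (splitCumul_top_le hp hp1 _)⟩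
  · rintro ⟨h1, h2⟩
    classical
    have hex : ∃ a, u < splitCumul p ⊤ (a + 1) := by
      have := (hasSum_splitWeight_top hp hp1).tendsto_sum_nat
      have := (Filter.tendsto_add_atTop_iff_nat 1).2 this
      exact (this.eventually (lt_mem_nhds h2)).exists
    refine ⟨Nat.find hex, ?_, Nat.find_spec hex⟩
    rcases h : Nat.find hex with _ | b
    · simpa using h1
    · exact not_lt.1 (Nat.find_min hex (m := b) (by omega))

/-- Equality holds only almost everywhere: u = p would require a partial sum to reach its limit 1 -
p. -/
lemma iUnion_Ico_splitCumul_top_reflect {p : ℝ} (hp : 1 / 2 < p) (hp1 : p ≤ 1) :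
    (⋃ a : ℕ, Ico (1 - splitCumul p ⊤ (a + 1)) (1 - splitCumul p ⊤ a) : Set ℝ)
      =ᵐ[volume] Ico p 1 := by
  have hm := splitCumul_mono (by linarith) hp1 ⊤
  refine Filter.EventuallyLE.antisymm (LE.le.eventuallyLE ?_)
    (Ioo_ae_eq_Ico.symm.le.trans (LE.le.eventuallyLE ?_))
  · refine iUnion_subset fun a u hu => ?_
    have := hm (Nat.zero_le a)
    rw [splitCumul_zero] at this
    have := splitCumul_top_le hp hp1 (a + 1)
    exact ⟨by linarith [hu.1], by linarith [hu.2]⟩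
  · rintro u ⟨h1, h2⟩
    classical
    have hex : ∃ a, 1 - u ≤ splitCumul p ⊤ (a + 1) := by
      have := (hasSum_splitWeight_top hp hp1).tendsto_sum_nat
      have := (Filter.tendsto_add_atTop_iff_nat 1).2 this
      exact (this.eventually (le_mem_nhds (by linarith : 1 - u < 1 - p))).exists
    rw [mem_iUnion]
    refine ⟨Nat.find hex, by linarith [Nat.find_spec hex], ?_⟩
    rcases h : Nat.find hex with _ | b
    · simpa using h2
    · linarith [not_le.1 (Nat.find_min hex (m := b) (by omega))]

/-- The label interval falls into three zones: on [0, 1-p) only the left size is finite, on [1-p, p)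
both are infinite, on [p, 1) only the right size is finite. -/
lemma lintegral_split_top {p : ℝ} (hp : 1 / 2 < p) (hp1 : p ≤ 1) (f : ℕ∞ → ℕ∞ → ℝ≥0∞) :
    ∫⁻ u, f (leftSize p ⊤ u) (rightSize p ⊤ u) ∂unitUniform =
      ENNReal.ofReal (2 * p - 1) * f ⊤ ⊤ +
        ∑' a : ℕ, ENNReal.ofReal (splitWeight p ⊤ a) * f a ⊤ +
        ∑' a : ℕ, ENNReal.ofReal (splitWeight p ⊤ a) * f ⊤ a := by
  have hp0 : 0 ≤ p := by linarith
  have hm := splitCumul_mono hp0 hp1 ⊤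
  have hdisj : ∀ {a b c : ℝ}, Disjoint (Ico a b) (Ico b c) := fun {a b c} => by
    rw [Set.disjoint_left]; intro x hx hx'; exact absurd hx.2 (not_lt.2 hx'.1)
  rw [unitUniform, ← Ico_union_Ico_eq_Ico hp0 hp1,
    ← Ico_union_Ico_eq_Ico (by linarith : 0 ≤ 1 - p) (by linarith : 1 - p ≤ p),
    lintegral_union measurableSet_Ico ?_, lintegral_union measurableSet_Ico hdisj]
  · have h1 : ∫⁻ u in Ico 0 (1 - p), f (leftSize p ⊤ u) (rightSize p ⊤ u) =
        ∑' a : ℕ, ENNReal.ofReal (splitWeight p ⊤ a) * f a ⊤ := by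
      rw [← iUnion_Ico_splitCumul_top hp hp1, lintegral_iUnion (fun _ => measurableSet_Ico)
        (by exact hm.pairwise_disjoint_on_Ico_succ)]
      refine tsum_congr fun a => ?_
      rw [setLIntegral_split measurableSet_Ico fun u hu => ⟨leftSize_top hp0 hp1 hu,
        rightSize_top_of_lt hp hp1 (by linarith [hu.2, splitCumul_top_le hp hp1 (a + 1)])⟩,
        Real.volume_Ico, splitCumul_succ, add_sub_cancel_left]
    have h2 : ∫⁻ u in Ico (1 - p) p, f (leftSize p ⊤ u) (rightSize p ⊤ u) =
        ENNReal.ofReal (2 * p - 1) * f ⊤ ⊤ := by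
      rw [setLIntegral_split measurableSet_Ico fun u hu => ⟨leftSize_top_of_le hp hp1 hu.1,
        rightSize_top_of_lt hp hp1 hu.2⟩, Real.volume_Ico, show p - (1 - p) = 2 * p - 1 by ring]
    have h3 : ∫⁻ u in Ico p 1, f (leftSize p ⊤ u) (rightSize p ⊤ u) =
        ∑' a : ℕ, ENNReal.ofReal (splitWeight p ⊤ a) * f ⊤ a := by
      rw [← setLIntegral_congr (iUnion_Ico_splitCumul_top_reflect hp hp1),
        lintegral_iUnion (fun _ => measurableSet_Ico)]
      · refine tsum_congr fun a => ?_
        rw [setLIntegral_split measurableSet_Ico fun u hu => ⟨leftSize_top_of_le hp hp1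
          (by linarith [hu.1, splitCumul_top_le hp hp1 (a + 1)]),
          rightSize_top hp0 hp1 (a := a) ⟨by linarith [hu.2], by linarith [hu.1]⟩⟩,
          Real.volume_Ico, splitCumul_succ]
        congr 2
        ring
      · exact Antitone.pairwise_disjoint_on_Ico_succ
          (f := fun a => 1 - splitCumul p ⊤ a) fun a b hab => by linarith [hm hab]
    rw [h1, h2, h3]
    ring
  · rw [Ico_union_Ico_eq_Ico (by linarith) (by linarith)]
    exact hdisj

/-! ### The coupled random trees. -/

section SplitTree

variable (p : ℝ) (U : Vertex → ℝ) (N : ℕ∞)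

/-- The number of nodes in the binary subtrees rooted at `v ++ [0], v ++ [1], …`, if `M` nodes are
available at `v ++ [0]`. -/
noncomputable def siblingSize (v : Vertex) (M : ℕ∞) : ℕ → ℕ∞
  | 0 => M
  | i + 1 => rightSize p (siblingSize v M i) (U (v ++ [i]))

/-- The number of strict descendants of the vertex `v` in the random tree of size `N`. -/
noncomputable def childSize (v : Vertex) : ℕ∞ :=
  (v.foldl (fun (s : Vertex × ℕ∞) i =>
    (s.1 ++ [i], leftSize p (siblingSize p U s.1 s.2 i) (U (s.1 ++ [i])))) ([], N)).2

/-- The number of nodes in the binary subtree of the random tree of size `N` which is rooted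
at `v ++ [i]`. -/
noncomputable def nodeSize (v : Vertex) (i : ℕ) : ℕ∞ :=
  siblingSize p U v (childSize p U N v) i

lemma nodeSize_root : nodeSize p U N [] 0 = N := rfl

lemma nodeSize_sibling (v : Vertex) (i : ℕ) :
    nodeSize p U N v (i + 1) = rightSize p (nodeSize p U N v i) (U (v ++ [i])) := rfl

lemma nodeSize_child (v : Vertex) (i : ℕ) :
    nodeSize p U N (v ++ [i]) 0 = leftSize p (nodeSize p U N v i) (U (v ++ [i])) := by
  -- The first component of the fold merely rebuilds the word read so far.
  have h : ∀ w : Vertex, (w.foldl (fun (s : Vertex × ℕ∞) i =>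
    (s.1 ++ [i], leftSize p (siblingSize p U s.1 s.2 i) (U (s.1 ++ [i])))) ([], N)).1 = w := by
    intro w
    induction w using List.reverseRecOn with
    | nil => rfl
    | append_singleton w a ih => rw [List.foldl_append, List.foldl_cons, List.foldl_nil, ih]
  simp only [nodeSize, siblingSize]
  conv_lhs => rw [childSize, List.foldl_append, List.foldl_cons, List.foldl_nil]
  simp only [h]
  rfl

/-- The random plane tree with `N + 1` vertices, driven by the labels `U`. -/
def splitTree : Set Vertex := insert [] {w | ∃ v i, w = v ++ [i] ∧ nodeSize p U N v i ≠ 0}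

variable {p U N}

lemma append_mem_splitTree {v : Vertex} {i : ℕ} :
    v ++ [i] ∈ splitTree p U N ↔ nodeSize p U N v i ≠ 0 := by
  constructor
  · rintro (h | ⟨w, j, h, h'⟩)
    · simp at h
    · obtain ⟨rfl, h2⟩ := List.append_inj' h rfl
      obtain rfl : i = j := by simpa using h2
      exact h'
  · exact fun h => .inr ⟨v, i, rfl, h⟩

lemma nodeSize_ne_zero_of_sibling {v : Vertex} {i : ℕ} (h : nodeSize p U N v (i + 1) ≠ 0) :
    nodeSize p U N v i ≠ 0 := fun h0 => h (by rw [nodeSize_sibling, h0, rightSize_zero])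

lemma nodeSize_zero_ne_zero {v : Vertex} {i : ℕ} (h : nodeSize p U N v i ≠ 0) :
    nodeSize p U N v 0 ≠ 0 := by
  induction i with
  | zero => exact h
  | succ i ih => exact ih (nodeSize_ne_zero_of_sibling h)

lemma isPlaneTree_splitTree : IsPlaneTree (splitTree p U N) where
  root_mem := mem_insert _ _
  parent_mem v i h := by
    rw [append_mem_splitTree] at h
    have h := nodeSize_zero_ne_zero h
    rcases List.eq_nil_or_concat' v with rfl | ⟨w, j, rfl⟩
    · exact mem_insert _ _
    · rw [append_mem_splitTree]
      exact fun h0 => h (by rw [nodeSize_child, h0, leftSize_zero])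
  sibling_mem v i h := by
    rw [append_mem_splitTree] at *
    exact nodeSize_ne_zero_of_sibling h

lemma nodeSize_mono (hp : 0 ≤ p) (hp1 : p ≤ 1) {M : ℕ∞} (h : N ≤ M) (v : Vertex) (i : ℕ) :
    nodeSize p U N v i ≤ nodeSize p U M v i := by
  induction v using List.reverseRecOn generalizing i with
  | nil =>
    induction i with
    | zero => simpa [nodeSize_root] using h
    | succ i ih =>
      rw [nodeSize_sibling, nodeSize_sibling]
      exact (rightSize_mono hp hp1 ih _)
  | append_singleton v j ihv =>
    induction i with
    | zero =>
      rw [nodeSize_child, nodeSize_child]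
      exact leftSize_mono hp hp1 (ihv j) _
    | succ i ih =>
      rw [nodeSize_sibling, nodeSize_sibling]
      exact (rightSize_mono hp hp1 ih _)

lemma splitTree_mono (hp : 0 ≤ p) (hp1 : p ≤ 1) {M : ℕ∞} (h : N ≤ M) :
    splitTree p U N ⊆ splitTree p U M := by
  rintro w (rfl | ⟨v, i, rfl, hv⟩)
  · exact mem_insert _ _
  · refine append_mem_splitTree.2 fun h0 => hv ?_
    simpa [h0] using nodeSize_mono (U := U) hp hp1 h v i

/-- The left and right sizes of a finite node add up exactly to one less than its size, so the
number of nodes built equals the number available. This needs labels in [0, 1). -/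
lemma exists_splitTree_inter_branch_eq (hp : 0 ≤ p) (hp1 : p ≤ 1) (hU : ∀ v, U v ∈ Ico (0 : ℝ) 1)
    (n : ℕ) (v : Vertex) (i : ℕ) (h : nodeSize p U N v i = n) :
    ∃ F : BinaryTree Unit, F.numNodes = n ∧ splitTree p U N ∩ branch v i = place v i F := by
  induction n using Nat.strong_induction_on generalizing v i with
  | _ n ih =>
    rcases n with _ | n
    · exact ⟨.nil, rfl, isPlaneTree_splitTree.inter_branch_eq_empty
        (by rw [append_mem_splitTree, h]; simp)⟩
    · obtain ⟨a, ha, hl, hr⟩ := leftSize_add_rightSize hp hp1 n (hU (v ++ [i]))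
      rw [← h, ← nodeSize_child] at hl
      rw [← h, ← nodeSize_sibling] at hr
      obtain ⟨l, hl1, hl2⟩ := ih a (by omega) _ _ hl
      obtain ⟨r, hr1, hr2⟩ := ih (n - a) (by omega) _ _ hr
      refine ⟨.node () l r, by simp only [BinaryTree.numNodes]; omega, ?_⟩
      rw [IsPlaneTree.inter_branch_eq, hl2, hr2, place]
      rw [append_mem_splitTree, h]
      exact_mod_cast Nat.succ_ne_zero n

lemma exists_splitTree_eq (hp : 0 ≤ p) (hp1 : p ≤ 1) (hU : ∀ v, U v ∈ Ico (0 : ℝ) 1) (n : ℕ) :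
    ∃ F : BinaryTree Unit, F.numNodes = n ∧ splitTree p U n = planeTree F := by
  obtain ⟨F, h1, h2⟩ := exists_splitTree_inter_branch_eq (N := n) hp hp1 hU n [] 0
    (nodeSize_root p U n)
  exact ⟨F, h1, by rw [isPlaneTree_splitTree.eq_insert_root, h2, planeTree]⟩

end SplitTree

/-! ### Probabilities of containing a finite tree. -/

/-- The law of independent uniform labels at all vertices. -/
noncomputable def labelLaw : Measure (Vertex → ℝ) := Measure.infinitePi fun _ => unitUniform

instance : IsProbabilityMeasure labelLaw := by unfold labelLaw; infer_instance

/-- The event that the binary tree planted at `v ++ [i]` is contained in the random tree, given that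
`N` nodes are available at `v ++ [i]`. -/
def containEvent (p : ℝ) : Vertex → ℕ → ℕ∞ → BinaryTree Unit → Set (Vertex → ℝ)
  | _, _, _, .nil => univ
  | v, i, N, .node _ l r => {U | N ≠ 0 ∧
      U ∈ containEvent p (v ++ [i]) 0 (leftSize p N (U (v ++ [i]))) l ∧
      U ∈ containEvent p v (i + 1) (rightSize p N (U (v ++ [i]))) r}

/-- The probability of `containEvent`. -/
noncomputable def containProb (p : ℝ) : ℕ∞ → BinaryTree Unit → ℝ≥0∞
  | _, .nil => 1
  | N, .node _ l r => if N = 0 then 0 else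
      ∫⁻ u, containProb p (leftSize p N u) l * containProb p (rightSize p N u) r ∂unitUniform

lemma place_subset_splitTree_iff {p : ℝ} {U : Vertex → ℝ} {N : ℕ∞} (F : BinaryTree Unit)
    (v : Vertex) (i : ℕ) : place v i F ⊆ splitTree p U N ↔
      U ∈ containEvent p v i (nodeSize p U N v i) F := by
  induction F generalizing v i with
  | nil => simp [place, containEvent]
  | node _ l r hl hr =>
    rw [place, containEvent, insert_subset_iff, union_subset_iff, hl, hr, append_mem_splitTree,
      nodeSize_child, nodeSize_sibling]
    rfl

lemma planeTree_subset_splitTree_iff {p : ℝ} {U : Vertex → ℝ} {N : ℕ∞} (F : BinaryTree Unit) :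
    planeTree F ⊆ splitTree p U N ↔ U ∈ containEvent p [] 0 N F := by
  rw [planeTree, insert_subset_iff, place_subset_splitTree_iff, nodeSize_root]
  exact and_iff_right isPlaneTree_splitTree.root_mem

/-- The σ-algebra generated by the labels in the set `S` of vertices. -/
abbrev labelSigma (S : Set Vertex) : MeasurableSpace (Vertex → ℝ) :=
  ⨆ w ∈ S, MeasurableSpace.comap (fun U : Vertex → ℝ => U w) inferInstance

lemma labelSigma_mono {S T : Set Vertex} (h : S ⊆ T) : labelSigma S ≤ labelSigma T :=
  biSup_mono h

lemma labelSigma_le (S : Set Vertex) : labelSigma S ≤ MeasurableSpace.pi :=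
  iSup₂_le fun w _ => (measurable_pi_apply w).comap_le

lemma measurableSet_labelSigma_preimage {S : Set Vertex} {w : Vertex} (hw : w ∈ S) {A : Set ℝ}
    (hA : MeasurableSet A) : MeasurableSet[labelSigma S] ((fun U : Vertex → ℝ => U w) ⁻¹' A) :=
  (le_iSup₂_of_le (f := fun w (_ : w ∈ S) =>
    MeasurableSpace.comap (fun U : Vertex → ℝ => U w) inferInstance) w hw le_rfl) _ ⟨A, hA, rfl⟩

lemma indep_labelSigma {S T : Set Vertex} (h : Disjoint S T) :
    Indep (labelSigma S) (labelSigma T) labelLaw := by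
  refine indep_iSup_of_disjoint (fun w => (measurable_pi_apply w).comap_le) ?_ h
  have := iIndepFun_infinitePi (P := fun _ : Vertex => unitUniform) (X := fun _ u => u)
    (fun _ => measurable_id)
  exact (iIndepFun_iff_iIndep _ _ _).1 this

lemma measurableSet_splitSize (p : ℝ) (N a b : ℕ∞) :
    MeasurableSet {u | leftSize p N u = a ∧ rightSize p N u = b} :=
  (measurable_leftSize p N (measurableSet_singleton a)).inter
    (measurable_rightSize p N (measurableSet_singleton b))

/-- The random sizes handed to the subtrees are frozen by a countable partition, so that each piece
is an intersection of events with deterministic sizes, to which independence applies. -/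
lemma containEvent_node {p : ℝ} {v : Vertex} {i : ℕ} {N : ℕ∞} (hN : N ≠ 0) {x : Unit}
    {l r : BinaryTree Unit} : containEvent p v i N (.node x l r) =
      ⋃ ab : ℕ∞ × ℕ∞, (fun U : Vertex → ℝ => U (v ++ [i])) ⁻¹'
          {u | leftSize p N u = ab.1 ∧ rightSize p N u = ab.2} ∩
        (containEvent p (v ++ [i]) 0 ab.1 l ∩ containEvent p v (i + 1) ab.2 r) := by
  ext U
  simp only [containEvent, mem_iUnion, mem_inter_iff, mem_preimage, Prod.exists]
  constructor
  · rintro ⟨-, h1, h2⟩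
    exact ⟨_, _, ⟨rfl, rfl⟩, h1, h2⟩
  · rintro ⟨a, b, ⟨rfl, rfl⟩, h1, h2⟩
    exact ⟨hN, h1, h2⟩

lemma containEvent_node_zero {p : ℝ} {v : Vertex} {i : ℕ} {x : Unit}
    {l r : BinaryTree Unit} : containEvent p v i 0 (.node x l r) = ∅ := by
  ext U
  simp [containEvent]

lemma measurableSet_containEvent (p : ℝ) (F : BinaryTree Unit) (v : Vertex) (i : ℕ) (N : ℕ∞) :
    MeasurableSet[labelSigma (branch v i)] (containEvent p v i N F) := by
  induction F generalizing v i N with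
  | nil => exact MeasurableSet.univ
  | node x l r hl hr =>
    by_cases hN : N = 0
    · rw [hN, containEvent_node_zero]
      exact @MeasurableSet.empty _ (labelSigma _)
    · rw [containEvent_node hN]
      refine @MeasurableSet.iUnion _ _ (labelSigma _) _ _ fun ab => ?_
      refine @MeasurableSet.inter _ (labelSigma _) _ _ (measurableSet_labelSigma_preimage
        (self_mem_branch v i) (measurableSet_splitSize p N _ _))
        (@MeasurableSet.inter _ (labelSigma _) _ _ ?_ ?_)
      · exact labelSigma_mono (branch_child_subset v i) _ (hl _ _ _)
      · exact labelSigma_mono (branch_sibling_subset v i) _ (hr _ _ _)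

lemma labelLaw_preimage (w : Vertex) {A : Set ℝ} (hA : MeasurableSet A) :
    labelLaw ((fun U : Vertex → ℝ => U w) ⁻¹' A) = unitUniform A :=
  (measurePreserving_eval_infinitePi (fun _ : Vertex => unitUniform) w).measure_preimage
    hA.nullMeasurableSet

/-- The label at `v ++ [i]` and the labels of the child and sibling branches sit on disjoint vertex
sets. The event for each frozen split is therefore a product, and summing over the splits recovers
the integral over u. -/
lemma labelLaw_containEvent (p : ℝ) (F : BinaryTree Unit) (v : Vertex) (i : ℕ) (N : ℕ∞) :
    labelLaw (containEvent p v i N F) = containProb p N F := by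
  induction F generalizing v i N with
  | nil => simp [containEvent, containProb]
  | node x l r hl hr =>
    by_cases hN : N = 0
    · rw [hN, containEvent_node_zero, containProb, if_pos rfl, measure_empty]
    have hmeas := fun (a : ℕ∞) => measurableSet_containEvent p l (v ++ [i]) 0 a
    have hmeas' := fun (b : ℕ∞) => measurableSet_containEvent p r v (i + 1) b
    have hsplit := measurableSet_splitSize p N
    rw [containEvent_node hN, measure_iUnion, containProb, if_neg hN]
    · have hmap : Measurable fun u => (leftSize p N u, rightSize p N u) :=
        (measurable_leftSize p N).prodMk (measurable_rightSize p N)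
      have h1 := lintegral_map (μ := unitUniform)
        (f := fun ab : ℕ∞ × ℕ∞ => containProb p ab.1 l * containProb p ab.2 r)
        (measurable_of_countable _) hmap
      rw [← h1, lintegral_countable']
      refine tsum_congr fun ⟨a, b⟩ => ?_
      have hd1 : Disjoint {v ++ [i]} (branch (v ++ [i]) 0 ∪ branch v (i + 1)) := by
        rw [Set.disjoint_singleton_left]
        rintro (h | h)
        · exact self_notMem_branch_child v i h
        · exact self_notMem_branch_sibling v i h
      have h2 : MeasurableSet[labelSigma (branch (v ++ [i]) 0 ∪ branch v (i + 1))]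
          (containEvent p (v ++ [i]) 0 a l ∩ containEvent p v (i + 1) b r) :=
        @MeasurableSet.inter _ (labelSigma _) _ _ (labelSigma_mono subset_union_left _ (hmeas a))
          (labelSigma_mono subset_union_right _ (hmeas' b))
      rw [(Indep_iff _ _ _).1 (indep_labelSigma hd1) _ _
          (measurableSet_labelSigma_preimage (mem_singleton _) (hsplit a b)) h2,
        (Indep_iff _ _ _).1 (indep_labelSigma (disjoint_branch v i)) _ _ (hmeas a) (hmeas' b),
        hl, hr, labelLaw_preimage _ (hsplit a b), mul_comm,
        Measure.map_apply hmap (measurableSet_singleton _)]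
      congr 2
      ext u
      simp
    · rintro ⟨a, b⟩ ⟨c, d⟩ hne
      rw [Function.onFun, Set.disjoint_left]
      rintro U ⟨⟨h1, h2⟩, -⟩ ⟨⟨h3, h4⟩, -⟩
      exact hne (Prod.ext (h1.symm.trans h3) (h2.symm.trans h4))
    · rintro ⟨a, b⟩
      exact (measurable_pi_apply (v ++ [i]) (hsplit a b)).inter
        ((labelSigma_le _ _ (hmeas a)).inter (labelSigma_le _ _ (hmeas' b)))

lemma measurableSet_containEvent_pi (p : ℝ) (F : BinaryTree Unit) (v : Vertex) (i : ℕ) (N : ℕ∞) :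
    MeasurableSet (containEvent p v i N F) :=
  labelSigma_le _ _ (measurableSet_containEvent p F v i N)

lemma containProb_node_succ {p : ℝ} (hp : 0 ≤ p) (hp1 : p ≤ 1) (n : ℕ) (x : Unit)
    (l r : BinaryTree Unit) : containProb p (n + 1 : ℕ) (.node x l r) =
      ∑ a ∈ Finset.range (n + 1), ENNReal.ofReal (splitWeight p (n + 1 : ℕ) a) *
        (containProb p a l * containProb p (n - a : ℕ) r) := by
  rw [containProb, if_neg (by exact_mod_cast Nat.succ_ne_zero n),
    lintegral_split_coe hp hp1 n fun a b => containProb p a l * containProb p b r]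

lemma containProb_eq_zero {p : ℝ} (hp : 0 ≤ p) (hp1 : p ≤ 1) {n : ℕ} {F : BinaryTree Unit}
    (h : n < F.numNodes) : containProb p n F = 0 := by
  induction F generalizing n with
  | nil => simp [BinaryTree.numNodes] at h
  | node x l r hl hr =>
    rcases n with _ | n
    · simp [containProb]
    · rw [containProb_node_succ hp hp1]
      refine Finset.sum_eq_zero fun a ha => ?_
      simp only [BinaryTree.numNodes] at h
      rw [Finset.mem_range] at ha
      rcases lt_or_ge a l.numNodes with h1 | h1
      · simp [hl h1]
      · rw [hr (show n - a < r.numNodes by omega), mul_zero, mul_zero]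

/-- Equal sizes force every split to be the one of `F`, so a single term survives at each node and
the Catalan factors cancel. -/
lemma containProb_numNodes {p : ℝ} (hp : 0 ≤ p) (hp1 : p ≤ 1) (F : BinaryTree Unit) :
    containProb p F.numNodes F = ENNReal.ofReal (1 / catalan F.numNodes) := by
  induction F with
  | nil => simp [containProb, BinaryTree.numNodes]
  | node x l r hl hr =>
    simp only [BinaryTree.numNodes]
    rw [containProb_node_succ hp hp1, Finset.sum_eq_single l.numNodes]
    · rw [Nat.add_sub_cancel_left, hl, hr, ← ENNReal.ofReal_mul (by positivity),
        ← ENNReal.ofReal_mul (splitWeight_nonneg hp hp1 _ _), splitWeight_coe,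
        show l.numNodes + r.numNodes + 1 - 1 - l.numNodes = r.numNodes by omega]
      congr 1
      have := (cast_catalan_pos l.numNodes).ne'
      have := (cast_catalan_pos r.numNodes).ne'
      field_simp
    · intro a ha hne
      rw [Finset.mem_range] at ha
      rcases lt_or_ge a l.numNodes with h1 | h1
      · simp [containProb_eq_zero hp hp1 h1]
      · rw [containProb_eq_zero hp hp1
          (show l.numNodes + r.numNodes - a < r.numNodes by omega), mul_zero, mul_zero]
    · intro h
      exact absurd (Finset.mem_range.2 (by omega)) h

/-! ### Finite and infinite percolation clusters. -/

/-- The probability that the percolation cluster with parameter `p` on the binary tree has exactly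
`m` nodes. -/
noncomputable def clusterWeight (p : ℝ) (m : ℕ) : ℝ := catalan m * p ^ m * (1 - p) ^ (m + 1)

lemma clusterWeight_nonneg {p : ℝ} (hp : 0 ≤ p) (hp1 : p ≤ 1) (m : ℕ) : 0 ≤ clusterWeight p m := by
  have : 0 ≤ 1 - p := by linarith
  unfold clusterWeight
  positivity

lemma hasSum_clusterWeight {p : ℝ} (hp : 1 / 2 < p) (hp1 : p ≤ 1) :
    HasSum (clusterWeight p) ((1 - p) / p) := by
  have h := (hasSum_catalan hp hp1).mul_left (1 - p)
  have h2 : clusterWeight p = fun m => (1 - p) * ((catalan m : ℝ) * (p * (1 - p)) ^ m) := by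
    funext m
    rw [clusterWeight, pow_succ, mul_pow]
    ring
  rw [h2, div_eq_mul_one_div]
  exact h

/-- The probability that the percolation cluster is finite and contains a given tree. -/
noncomputable def finiteContainProb (p : ℝ) (F : BinaryTree Unit) : ℝ≥0∞ :=
  ∑' m : ℕ, ENNReal.ofReal (clusterWeight p m) * containProb p m F

lemma tsum_mul_tsum_eq_tsum_sum_range (f g : ℕ → ℝ≥0∞) : (∑' a, f a) * ∑' b, g b =
    ∑' m, ∑ a ∈ Finset.range (m + 1), f a * g (m - a) := by
  rw [← ENNReal.tsum_mul_right]
  simp only [← ENNReal.tsum_mul_left]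
  rw [← ENNReal.tsum_prod (f := fun a b => f a * g b),
    ← Finset.HasAntidiagonal.sigmaAntidiagonalEquivProd.tsum_eq, ENNReal.tsum_sigma']
  refine tsum_congr fun m => ?_
  rw [← Finset.Nat.sum_antidiagonal_eq_sum_range_succ (fun a b => f a * g b)]
  exact Finset.tsum_subtype _ fun ij : ℕ × ℕ => f ij.1 * g ij.2

lemma finiteContainProb_nil {p : ℝ} (hp : 1 / 2 < p) (hp1 : p ≤ 1) :
    finiteContainProb p .nil = ENNReal.ofReal ((1 - p) / p) := by
  have h := hasSum_clusterWeight hp hp1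
  simp only [finiteContainProb, containProb, mul_one]
  rw [← ENNReal.ofReal_tsum_of_nonneg (clusterWeight_nonneg (by linarith) hp1) h.summable,
    h.tsum_eq]

/-- The root is kept with probability p, and the two subclusters are then independent and must both
be finite. In weights, a cluster of size m + 1 split as (a, m - a) has p times the product of the
weights of its parts. -/
lemma finiteContainProb_node {p : ℝ} (hp : 0 ≤ p) (hp1 : p ≤ 1) (x : Unit)
    (l r : BinaryTree Unit) : finiteContainProb p (.node x l r) =
      ENNReal.ofReal p * (finiteContainProb p l * finiteContainProb p r) := by
  simp only [finiteContainProb]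
  rw [tsum_mul_tsum_eq_tsum_sum_range, tsum_eq_zero_add' ENNReal.summable, ← ENNReal.tsum_mul_left]
  have h0 : containProb p (0 : ℕ) (.node x l r) = 0 := by simp [containProb]
  rw [h0, mul_zero, zero_add]
  refine tsum_congr fun m => ?_
  rw [containProb_node_succ hp hp1, Finset.mul_sum, Finset.mul_sum]
  refine Finset.sum_congr rfl fun a ha => ?_
  have ha : a ≤ m := by rw [Finset.mem_range] at ha; omega
  have h1 : clusterWeight p (m + 1) * splitWeight p (m + 1 : ℕ) a =
      p * (clusterWeight p a * clusterWeight p (m - a)) := by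
    obtain ⟨b, rfl⟩ := Nat.exists_eq_add_of_le ha
    have := (cast_catalan_pos (a + b + 1)).ne'
    simp only [clusterWeight, splitWeight_coe]
    rw [show a + b + 1 - 1 - a = b by omega, Nat.add_sub_cancel_left]
    field_simp
    ring
  rw [← mul_assoc, ← ENNReal.ofReal_mul (clusterWeight_nonneg hp hp1 _), h1,
    ENNReal.ofReal_mul hp, ENNReal.ofReal_mul (clusterWeight_nonneg hp hp1 _)]
  ring

lemma containProb_top_node {p : ℝ} (hp : 1 / 2 < p) (hp1 : p ≤ 1) (x : Unit)
    (l r : BinaryTree Unit) : containProb p ⊤ (.node x l r) =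
      ENNReal.ofReal (2 * p - 1) * (containProb p ⊤ l * containProb p ⊤ r) +
      ENNReal.ofReal p * (finiteContainProb p l * containProb p ⊤ r) +
      ENNReal.ofReal p * (containProb p ⊤ l * finiteContainProb p r) := by
  have hw : ∀ a, ENNReal.ofReal (splitWeight p ⊤ a) =
      ENNReal.ofReal p * ENNReal.ofReal (clusterWeight p a) := by
    intro a
    rw [← ENNReal.ofReal_mul (by linarith), splitWeight_top, clusterWeight, mul_pow]
    congr 1
    ring
  rw [containProb, if_neg (by simp),
    lintegral_split_top hp hp1 fun a b => containProb p a l * containProb p b r]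
  simp only [hw, finiteContainProb, ← ENNReal.tsum_mul_right, ← ENNReal.tsum_mul_left]
  congr 1
  · congr 1
    exact tsum_congr fun a => by ring
  · exact tsum_congr fun a => by ring

/-- A percolation cluster containing a given tree is either infinite or finite. -/
lemma containProb_top_add_finiteContainProb {p : ℝ} (hp : 1 / 2 < p) (hp1 : p ≤ 1)
    (F : BinaryTree Unit) :
    ENNReal.ofReal ((2 * p - 1) / p) * containProb p ⊤ F + finiteContainProb p F =
      ENNReal.ofReal p ^ F.numNodes := by
  have hp0 : 0 < p := by linarith
  induction F with
  | nil =>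
    rw [finiteContainProb_nil hp hp1, containProb, mul_one, ← ENNReal.ofReal_add
      (div_nonneg (by linarith) hp0.le) (div_nonneg (by linarith) hp0.le), BinaryTree.numNodes,
      pow_zero, ← add_div, show 2 * p - 1 + (1 - p) = p by ring, div_self hp0.ne',
      ENNReal.ofReal_one]
  | node x l r hl hr =>
    -- With θ = (2p-1)/p, c for `containProb p ⊤` and f for `finiteContainProb p`, the product p (θ
    -- c_l + f_l)(θ c_r + f_r) has exactly the required four terms, because 2p - 1 = pθ.
    rw [containProb_top_node hp hp1, finiteContainProb_node hp0.le hp1, BinaryTree.numNodes,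
      pow_succ, pow_add, ← hl, ← hr]
    have h : ENNReal.ofReal (2 * p - 1) = ENNReal.ofReal p * ENNReal.ofReal ((2 * p - 1) / p) := by
      rw [← ENNReal.ofReal_mul hp0.le, mul_div_cancel₀ _ hp0.ne']
    rw [h]
    ring

/-! ### The Galton–Watson tree. -/

lemma geomLaw_singleton (p : ℝ) (c : ℕ) :
    geomLaw p {(c : ℕ∞)} = ENNReal.ofReal (p ^ c * (1 - p)) := by
  have hs := measurableSet_singleton (c : ℕ∞)
  rw [geomLaw, Measure.add_apply, Measure.sum_apply _ hs, tsum_eq_single c]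
  · split_ifs <;> simp
  · intro n hn
    simp [hn]

lemma geomLaw_univ {p : ℝ} (hp : 0 ≤ p) (hp1 : p ≤ 1) : geomLaw p univ = 1 := by
  rw [geomLaw, Measure.add_apply, Measure.sum_apply _ MeasurableSet.univ]
  rcases hp1.eq_or_lt with rfl | h
  · simp
  · have h1 : HasSum (fun n => p ^ n * (1 - p)) 1 := by
      have := (hasSum_geometric_of_lt_one hp h).mul_right (1 - p)
      rwa [inv_mul_cancel₀ (by linarith)] at this
    have h2 : ∀ n, 0 ≤ p ^ n * (1 - p) := fun n => mul_nonneg (pow_nonneg hp n) (by linarith)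
    simp only [Measure.smul_apply, measure_univ, smul_eq_mul, mul_one, if_neg h.ne]
    rw [← ENNReal.ofReal_tsum_of_nonneg h2 h1.summable, h1.tsum_eq]
    simp

lemma geomLaw_Ici {p : ℝ} (hp : 0 ≤ p) (hp1 : p ≤ 1) (c : ℕ) :
    geomLaw p (Ici (c : ℕ∞)) = ENNReal.ofReal p ^ c := by
  induction c with
  | zero => simpa using geomLaw_univ hp hp1
  | succ c ih =>
    have h1 : Ici (c : ℕ∞) = {(c : ℕ∞)} ∪ Ici ((c + 1 : ℕ) : ℕ∞) := by
      ext x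
      induction x with
      | top => simp
      | coe n =>
        simp only [mem_Ici, mem_union, mem_singleton_iff, Nat.cast_le, Nat.cast_inj]
        omega
    rw [h1, measure_union _ (MeasurableSet.of_discrete), geomLaw_singleton] at ih
    · have h2 : ENNReal.ofReal p ^ c =
          ENNReal.ofReal (p ^ c * (1 - p)) + ENNReal.ofReal p ^ (c + 1) := by
        rw [← ENNReal.ofReal_pow hp, ← ENNReal.ofReal_pow hp, ← ENNReal.ofReal_add
          (mul_nonneg (pow_nonneg hp c) (by linarith)) (pow_nonneg hp _)]
        congr 1
        ring
      rw [h2] at ih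
      exact (ENNReal.add_right_inj ENNReal.ofReal_ne_top).1 ih
    · rw [Set.disjoint_singleton_left, mem_Ici, Nat.cast_le]
      omega

lemma nil_mem_gwTree (x : Vertex → ℕ∞) : [] ∈ gwTree x :=
  mem_iUnion.2 ⟨0, rfl⟩

lemma append_mem_gwTree {x : Vertex → ℕ∞} {v : Vertex} {i : ℕ} :
    v ++ [i] ∈ gwTree x ↔ v ∈ gwTree x ∧ (i : ℕ∞) < x v := by
  simp only [gwTree, mem_iUnion]
  constructor
  · rintro ⟨n, hn⟩
    rcases n with _ | n
    · exact absurd hn (by simp [gwGeneration])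
    · obtain ⟨w, hw, j, hj, h⟩ := hn
      obtain ⟨rfl, h2⟩ := List.append_inj' h rfl
      obtain rfl : i = j := by simpa using h2
      exact ⟨⟨n, hw⟩, hj⟩
  · rintro ⟨⟨n, hn⟩, h⟩
    exact ⟨n + 1, v, hn, i, h, rfl⟩

lemma isPlaneTree_gwTree (x : Vertex → ℕ∞) : IsPlaneTree (gwTree x) where
  root_mem := nil_mem_gwTree x
  parent_mem v i h := (append_mem_gwTree.1 h).1
  sibling_mem v i h := by
    rw [append_mem_gwTree] at *
    exact ⟨h.1, lt_of_le_of_lt (by exact_mod_cast Nat.le_succ i) h.2⟩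

lemma measurable_set_of_forall_mem {α : Type*} [MeasurableSpace α] {f : α → Set Vertex}
    (h : ∀ v, MeasurableSet {x | v ∈ f x}) : Measurable f :=
  measurable_set_iff.2 fun v => measurableSet_setOfPred.1 (h v)

lemma measurable_gwTree : Measurable gwTree := by
  refine measurable_set_of_forall_mem fun v => ?_
  induction v using List.reverseRecOn with
  | nil => simp [nil_mem_gwTree]
  | append_singleton v i ih =>
    simp only [append_mem_gwTree]
    have h : MeasurableSet {x : Vertex → ℕ∞ | (i : ℕ∞) < x v} :=
      (measurable_pi_apply v : Measurable fun x : Vertex → ℕ∞ => x v)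
        (MeasurableSet.of_discrete (s := Ioi (i : ℕ∞)))
    exact ih.inter h

/-- The number of children of the vertex `v` in the tree `t`. -/
def childCount (t : Finset Vertex) (v : Vertex) : ℕ :=
  ((t.erase []).filter fun w => w.dropLast = v).card

section FiniteTree

variable {t : Finset Vertex}

lemma append_mem_iff_lt_childCount (ht : IsPlaneTree (t : Set Vertex)) {v : Vertex} {j : ℕ} :
    v ++ [j] ∈ t ↔ j < childCount t v := by
  have hex : ∃ c, v ++ [c] ∉ t := by
    by_contra! h
    have hinj : Function.Injective fun c : ℕ => v ++ [c] := fun a b hab => by simpa using hab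
    exact infinite_range_of_injective hinj (t.finite_toSet.subset (range_subset_iff.2 h))
  have hc : ∀ j, v ++ [j] ∈ t ↔ j < Nat.find hex := fun j => by
    refine ⟨fun h => ?_, fun h => not_not.1 (Nat.find_min hex h)⟩
    by_contra hj
    exact Nat.find_spec hex (ht.sibling_mem_of_le (not_lt.1 hj) h)
  have hcount : childCount t v = Nat.find hex := by
    have : (t.erase []).filter (fun w => w.dropLast = v) =
        (Finset.range (Nat.find hex)).image fun j => v ++ [j] := by
      ext w
      simp only [Finset.mem_filter, Finset.mem_erase, Finset.mem_image, Finset.mem_range]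
      constructor
      · rintro ⟨⟨hw, hwt⟩, rfl⟩
        exact ⟨w.getLast hw, (hc _).1 (by rwa [List.dropLast_append_getLast]),
          List.dropLast_append_getLast hw⟩
      · rintro ⟨j, hj, rfl⟩
        exact ⟨⟨by simp, (hc j).2 hj⟩, by simp⟩
    rw [childCount, this, Finset.card_image_of_injective _ fun a b hab => by simpa using hab,
      Finset.card_range]
  rw [hcount, hc]

/-- Each non-root vertex is counted once, at its parent. -/
lemma sum_childCount (ht : IsPlaneTree (t : Set Vertex)) :
    ∑ v ∈ t, childCount t v + 1 = t.card := by
  have h : ∀ w ∈ t.erase [], w.dropLast ∈ t := by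
    intro w hw
    obtain ⟨hw1, hw2⟩ := Finset.mem_erase.1 hw
    exact ht.parent_mem _ (w.getLast hw1) (by rwa [List.dropLast_append_getLast])
  simp only [childCount]
  rw [← Finset.card_eq_sum_card_fiberwise h, Finset.card_erase_add_one ht.root_mem]

lemma subset_gwTree_iff (ht : IsPlaneTree (t : Set Vertex)) {x : Vertex → ℕ∞} :
    ↑t ⊆ gwTree x ↔ ∀ v ∈ t, (childCount t v : ℕ∞) ≤ x v := by
  constructor
  · intro h v hv
    rcases hc : childCount t v with _ | c
    · simp
    · have := (append_mem_gwTree.1 (h ((append_mem_iff_lt_childCount ht).2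
        (hc ▸ Nat.lt_succ_self c : c < childCount t v)))).2
      push_cast
      exact Order.add_one_le_of_lt this
  · intro h v hv
    induction v using List.reverseRecOn with
    | nil => exact nil_mem_gwTree x
    | append_singleton v i ih =>
      have hv' : v ∈ t := ht.parent_mem v i hv
      refine append_mem_gwTree.2 ⟨ih hv', lt_of_lt_of_le ?_ (h v hv')⟩
      exact_mod_cast (append_mem_iff_lt_childCount ht).1 hv

lemma gwTree_eq_iff (ht : IsPlaneTree (t : Set Vertex)) {x : Vertex → ℕ∞} :
    gwTree x = t ↔ ∀ v ∈ t, x v = childCount t v := by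
  constructor
  · intro h v hv
    refine le_antisymm ?_ ((subset_gwTree_iff ht).1 h.symm.subset v hv)
    by_contra! hlt
    have : v ++ [childCount t v] ∈ gwTree x := append_mem_gwTree.2 ⟨h.symm.subset hv, hlt⟩
    rw [h] at this
    exact lt_irrefl _ ((append_mem_iff_lt_childCount ht).1 this)
  · intro h
    refine Subset.antisymm ?_ ((subset_gwTree_iff ht).2 fun v hv => (h v hv).ge)
    intro v hv
    induction v using List.reverseRecOn with
    | nil => exact ht.root_mem
    | append_singleton v i ih =>
      obtain ⟨h1, h2⟩ := append_mem_gwTree.1 hv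
      rw [h v (ih h1)] at h2
      exact (append_mem_iff_lt_childCount ht).2 (by exact_mod_cast h2)

end FiniteTree

lemma measurableSet_setOf_subset (A : Set Vertex) : MeasurableSet {t : Set Vertex | A ⊆ t} := by
  have : {t : Set Vertex | A ⊆ t} = ⋂ v ∈ A, {t | v ∈ t} := by
    ext t; simp [subset_def]
  rw [this]
  exact MeasurableSet.biInter A.to_countable fun v _ => measurableSet_mem v

lemma measurableSet_isPlaneTree : MeasurableSet {t : Set Vertex | IsPlaneTree t} := by
  have h : {t : Set Vertex | IsPlaneTree t} = {t | [] ∈ t} ∩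
      ((⋂ (v : Vertex) (i : ℕ), {t | v ++ [i] ∈ t}ᶜ ∪ {t | v ∈ t}) ∩
        ⋂ (v : Vertex) (i : ℕ), {t | v ++ [i + 1] ∈ t}ᶜ ∪ {t | v ++ [i] ∈ t}) := by
    ext t
    simp only [mem_ofPred_eq, mem_inter_iff, mem_iInter, mem_union, mem_compl_iff, ← imp_iff_not_or]
    exact ⟨fun h => ⟨h.1, h.2, h.3⟩, fun h => ⟨h.1, h.2.1, h.2.2⟩⟩
  rw [h]
  refine (measurableSet_mem _).inter (MeasurableSet.inter ?_ ?_) <;>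
    exact MeasurableSet.iInter fun v => MeasurableSet.iInter fun i =>
      (measurableSet_mem _).compl.union (measurableSet_mem _)

lemma isProbabilityMeasure_geomLaw {p : ℝ} (hp : 0 ≤ p) (hp1 : p ≤ 1) :
    IsProbabilityMeasure (geomLaw p) := ⟨geomLaw_univ hp hp1⟩

lemma isProbabilityMeasure_gwLaw {p : ℝ} (hp : 0 ≤ p) (hp1 : p ≤ 1) :
    IsProbabilityMeasure (gwLaw p) := by
  have := isProbabilityMeasure_geomLaw hp hp1
  exact Measure.isProbabilityMeasure_map measurable_gwTree.aemeasurable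

lemma exists_finset_eq_planeTree (F : BinaryTree Unit) : ∃ t : Finset Vertex,
    (t : Set Vertex) = planeTree F ∧ ∑ v ∈ t, childCount t v = F.numNodes ∧
      t.card = F.numNodes + 1 := by
  lift planeTree F to Finset Vertex using finite_planeTree F with t ht
  have h1 : t.card = F.numNodes + 1 := by
    have := encard_planeTree F
    rw [← ht, encard_coe_eq_coe_finsetCard] at this
    exact_mod_cast this
  have h2 := sum_childCount (t := t) (ht ▸ isPlaneTree_planeTree F)
  exact ⟨t, rfl, by omega, h1⟩

/-- Containment asks each vertex of the finite tree for at least its number of children there. The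
geometric tails multiply to p raised to the total number of children. -/
lemma gwLaw_subset {p : ℝ} (hp : 0 ≤ p) (hp1 : p ≤ 1) (F : BinaryTree Unit) :
    gwLaw p {t | planeTree F ⊆ t} = ENNReal.ofReal p ^ F.numNodes := by
  have := isProbabilityMeasure_geomLaw hp hp1
  obtain ⟨t, ht, hsum, -⟩ := exists_finset_eq_planeTree F
  have hpt : IsPlaneTree (t : Set Vertex) := ht ▸ isPlaneTree_planeTree F
  rw [gwLaw, Measure.map_apply measurable_gwTree (measurableSet_setOf_subset _)]
  have h : gwTree ⁻¹' {s | planeTree F ⊆ s} =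
      Set.pi (t : Set Vertex) fun v => Ici (childCount t v : ℕ∞) := by
    ext x
    simp only [mem_preimage, mem_ofPred_eq, ← ht, subset_gwTree_iff hpt, Set.mem_pi, mem_Ici,
      Finset.mem_coe]
  rw [h, Measure.infinitePi_pi _ fun _ _ => MeasurableSet.of_discrete]
  simp only [geomLaw_Ici hp hp1]
  rw [Finset.prod_pow_eq_pow_sum, hsum]

lemma gwLaw_singleton {p : ℝ} (hp : 0 ≤ p) (hp1 : p ≤ 1) (F : BinaryTree Unit) :
    gwLaw p {planeTree F} = ENNReal.ofReal (p ^ F.numNodes * (1 - p) ^ (F.numNodes + 1)) := by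
  have := isProbabilityMeasure_geomLaw hp hp1
  obtain ⟨t, ht, hsum, hcard⟩ := exists_finset_eq_planeTree F
  have hpt : IsPlaneTree (t : Set Vertex) := ht ▸ isPlaneTree_planeTree F
  rw [gwLaw, Measure.map_apply measurable_gwTree (measurableSet_singleton _)]
  have h : gwTree ⁻¹' {planeTree F} =
      Set.pi (t : Set Vertex) fun v => {(childCount t v : ℕ∞)} := by
    ext x
    simp only [mem_preimage, mem_singleton_iff, ← ht, gwTree_eq_iff hpt, Set.mem_pi,
      Finset.mem_coe]
  rw [h, Measure.infinitePi_pi _ fun _ _ => MeasurableSet.of_discrete]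
  simp only [geomLaw_singleton]
  rw [← ENNReal.ofReal_prod_of_nonneg fun v _ => mul_nonneg (pow_nonneg hp _) (by linarith),
    Finset.prod_mul_distrib, Finset.prod_pow_eq_pow_sum, hsum, Finset.prod_const, hcard]

lemma ae_isPlaneTree_gwLaw (p : ℝ) : ∀ᵐ t ∂gwLaw p, IsPlaneTree t := by
  exact (ae_map_iff measurable_gwTree.aemeasurable measurableSet_isPlaneTree).2
    (ae_of_all _ isPlaneTree_gwTree)

/-! ### Identification of the laws. -/

lemma measurable_splitTree (p : ℝ) (N : ℕ∞) : Measurable fun U => splitTree p U N := by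
  refine measurable_set_of_forall_mem fun v => ?_
  obtain ⟨F, hF⟩ := exists_planeTree_hull {v}
  convert measurableSet_containEvent_pi p F [] 0 N
  ext U
  rw [← planeTree_subset_splitTree_iff, ← hF _ isPlaneTree_splitTree]
  simp

lemma labelLaw_planeTree_subset (p : ℝ) (N : ℕ∞) (F : BinaryTree Unit) :
    labelLaw {U | planeTree F ⊆ splitTree p U N} = containProb p N F := by
  rw [← labelLaw_containEvent p F [] 0 N]
  congr 1
  ext U
  exact planeTree_subset_splitTree_iff F

/-- The plane trees with `n + 1` vertices. -/
noncomputable def planeTreesOfNumNodes (n : ℕ) : Finset (Set Vertex) :=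
  (BinaryTree.treesOfNumNodesEq n).map ⟨planeTree, planeTree_injective⟩

lemma mem_planeTreesOfNumNodes {n : ℕ} {t : Set Vertex} :
    t ∈ planeTreesOfNumNodes n ↔ ∃ F : BinaryTree Unit, F.numNodes = n ∧ planeTree F = t := by
  simp [planeTreesOfNumNodes]

lemma card_planeTreesOfNumNodes (n : ℕ) : (planeTreesOfNumNodes n).card = catalan n := by
  rw [planeTreesOfNumNodes, Finset.card_map, BinaryTree.treesOfNumNodesEq_card_eq_catalan]

lemma coe_planeTreesOfNumNodes (n : ℕ) : (planeTreesOfNumNodes n : Set (Set Vertex)) =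
    {t | IsPlaneTree t ∧ t.encard = (n + 1 : ℕ)} := by
  ext t
  rw [Finset.mem_coe, mem_planeTreesOfNumNodes, mem_ofPred_eq]
  constructor
  · rintro ⟨F, rfl, rfl⟩
    exact ⟨isPlaneTree_planeTree F, by simp [encard_planeTree]⟩
  · rintro ⟨h1, h2⟩
    obtain ⟨F, rfl⟩ := h1.exists_eq_planeTree (finite_of_encard_eq_coe h2)
    rw [encard_planeTree] at h2
    have h2 : F.numNodes + 1 = n + 1 := by exact_mod_cast h2
    exact ⟨F, by omega, rfl⟩

lemma uniformTreeLaw_succ (n : ℕ) :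
    uniformTreeLaw (n + 1) = uniformOn (planeTreesOfNumNodes n : Set (Set Vertex)) := by
  rw [uniformTreeLaw, coe_planeTreesOfNumNodes]

lemma eq_uniformOn_of_singleton {α : Type*} [MeasurableSpace α] [MeasurableSingletonClass α]
    {μ : Measure α} [IsProbabilityMeasure μ] {S : Finset α} (hS : S.Nonempty)
    (h : ∀ s ∈ S, μ {s} = (S.card : ℝ≥0∞)⁻¹) : μ = uniformOn (S : Set α) := by
  classical
  have hfin : ∀ B ⊆ S, μ B = B.card * (S.card : ℝ≥0∞)⁻¹ := by
    intro B hB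
    rw [← sum_measure_singleton, Finset.sum_congr rfl fun s hs => h s (hB hs), Finset.sum_const,
      nsmul_eq_mul]
  have hone : μ S = 1 := by
    rw [hfin S subset_rfl, ENNReal.mul_inv_cancel] <;> simp [hS.ne_empty]
  have hzero : μ (S : Set α)ᶜ = 0 := (prob_compl_eq_zero_iff S.measurableSet).2 hone
  ext A hA
  have hcoe : ((S.filter (· ∈ A) : Finset α) : Set α) = ↑S ∩ A := by ext; simp
  have h1 : μ A = μ (S.filter (· ∈ A) : Finset α) := by
    rw [hcoe]
    refine measure_congr ?_
    filter_upwards [mem_ae_iff.2 hzero] with x hx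
    exact propext ⟨fun h => ⟨hx, h⟩, fun h => h.2⟩
  rw [h1, hfin _ (Finset.filter_subset _ _), ← uniformOn_inter_self S.finite_toSet, ← hcoe,
    uniformOn_apply_finset, Finset.inter_eq_right.2 (Finset.filter_subset _ _), div_eq_mul_inv]

lemma ae_labelLaw_mem_Ico : ∀ᵐ U ∂labelLaw, ∀ v, U v ∈ Ico (0 : ℝ) 1 := by
  refine ae_all_iff.2 fun v => ?_
  rw [ae_iff]
  have h := labelLaw_preimage v (measurableSet_Ico (a := (0 : ℝ)) (b := 1)).compl
  rw [unitUniform, Measure.restrict_apply (measurableSet_Ico).compl, compl_inter_self,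
    measure_empty] at h
  exact h

lemma hasLaw_splitTree {p : ℝ} (hp : 0 ≤ p) (hp1 : p ≤ 1) (n : ℕ) :
    HasLaw (fun U => splitTree p U n) (uniformTreeLaw (n + 1)) labelLaw := by
  have hmeas := measurable_splitTree p n
  refine ⟨hmeas.aemeasurable, ?_⟩
  have := Measure.isProbabilityMeasure_map (μ := labelLaw) hmeas.aemeasurable
  rw [uniformTreeLaw_succ]
  refine eq_uniformOn_of_singleton ?_ fun t ht => ?_
  · rw [← Finset.card_pos, card_planeTreesOfNumNodes]
    exact catalan_pos n
  obtain ⟨F, rfl, rfl⟩ := mem_planeTreesOfNumNodes.1 ht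
  have hprob : containProb p F.numNodes F = (catalan F.numNodes : ℝ≥0∞)⁻¹ := by
    rw [containProb_numNodes hp hp1, one_div, ENNReal.ofReal_inv_of_pos (cast_catalan_pos _),
      ENNReal.ofReal_natCast]
  rw [Measure.map_apply hmeas (measurableSet_singleton _), card_planeTreesOfNumNodes, ← hprob,
    ← labelLaw_planeTree_subset]
  refine measure_congr ?_
  filter_upwards [ae_labelLaw_mem_Ico] with U hU
  -- The split tree almost surely has the same number of vertices as `planeTree F`, so containing it
  -- means equalling it.
  refine propext ⟨fun h => (show splitTree p U _ = _ from h).symm.subset, fun h => ?_⟩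
  obtain ⟨G, hG1, hG2⟩ := exists_splitTree_eq hp hp1 hU F.numNodes
  have h : planeTree F ⊆ splitTree p U F.numNodes := h
  change splitTree p U F.numNodes = planeTree F
  rw [hG2] at h ⊢
  refine ((finite_planeTree F).eq_of_subset_of_encard_le h ?_).symm
  rw [encard_planeTree, encard_planeTree, hG1]

-- Uniformity turns the recursively defined `containProb` into a proportion of trees, which is how
-- it enters the finite Galton–Watson tree.
open scoped Classical in
lemma containProb_eq_card_div {p : ℝ} (hp : 0 ≤ p) (hp1 : p ≤ 1) (n : ℕ) (F : BinaryTree Unit) :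
    containProb p n F =
      ((planeTreesOfNumNodes n).filter (planeTree F ⊆ ·)).card / (catalan n : ℝ≥0∞) := by
  rw [← labelLaw_planeTree_subset,
    (hasLaw_splitTree hp hp1 n).measure_eq (measurableSet_setOf_subset (planeTree F)),
    uniformTreeLaw_succ, ← uniformOn_inter_self (Finset.finite_toSet _)]
  have hcoe : (((planeTreesOfNumNodes n).filter (planeTree F ⊆ ·) : Finset (Set Vertex)) :
      Set (Set Vertex)) = ↑(planeTreesOfNumNodes n) ∩ {t | planeTree F ⊆ t} := by ext; simp
  rw [← hcoe, uniformOn_apply_finset, Finset.inter_eq_right.2 (Finset.filter_subset _ _),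
    card_planeTreesOfNumNodes]

/-- All trees with n + 1 vertices have the same probability p^n (1-p)^{n+1}; given its size, a
finite T(p) is thus uniform. -/
lemma gwLaw_subset_finite {p : ℝ} (hp : 0 ≤ p) (hp1 : p ≤ 1) (F : BinaryTree Unit) :
    gwLaw p {t | planeTree F ⊆ t ∧ t.Finite} = finiteContainProb p F := by
  classical
  let S : ℕ → Finset (Set Vertex) := fun n => (planeTreesOfNumNodes n).filter (planeTree F ⊆ ·)
  have h : ({t | planeTree F ⊆ t ∧ t.Finite} : Set (Set Vertex)) =ᵐ[gwLaw p]
      ⋃ n, (S n : Set (Set Vertex)) := by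
    filter_upwards [ae_isPlaneTree_gwLaw p] with t ht
    refine propext ⟨fun h => ?_, fun h => ?_⟩
    · obtain ⟨G, rfl⟩ := ht.exists_eq_planeTree h.2
      exact mem_iUnion.2 ⟨G.numNodes, Finset.mem_coe.2 (Finset.mem_filter.2
        ⟨mem_planeTreesOfNumNodes.2 ⟨G, rfl, rfl⟩, h.1⟩)⟩
    · obtain ⟨n, hn⟩ := mem_iUnion.1 h
      obtain ⟨h1, h2⟩ := Finset.mem_filter.1 (Finset.mem_coe.1 hn)
      obtain ⟨G, -, rfl⟩ := mem_planeTreesOfNumNodes.1 h1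
      exact ⟨h2, finite_planeTree G⟩
  rw [measure_congr h, measure_iUnion, finiteContainProb]
  · refine tsum_congr fun n => ?_
    have hsingle : ∀ t ∈ S n, gwLaw p {t} = ENNReal.ofReal (p ^ n * (1 - p) ^ (n + 1)) := by
      intro t ht
      obtain ⟨G, rfl, rfl⟩ := mem_planeTreesOfNumNodes.1 (Finset.mem_filter.1 ht).1
      exact gwLaw_singleton hp hp1 G
    rw [← sum_measure_singleton, Finset.sum_congr rfl hsingle, Finset.sum_const, nsmul_eq_mul,
      containProb_eq_card_div hp hp1, clusterWeight, mul_assoc,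
      ENNReal.ofReal_mul (Nat.cast_nonneg _), ENNReal.ofReal_natCast, mul_comm (catalan n : ℝ≥0∞),
      mul_assoc, ENNReal.mul_div_cancel (by exact_mod_cast (catalan_pos n).ne')
        (ENNReal.natCast_ne_top _), mul_comm]
  · intro m n hmn
    rw [Function.onFun, Finset.disjoint_coe, Finset.disjoint_left]
    intro t ht ht'
    obtain ⟨G, hG, rfl⟩ := mem_planeTreesOfNumNodes.1 (Finset.mem_filter.1 ht).1
    obtain ⟨G', hG', h⟩ := mem_planeTreesOfNumNodes.1 (Finset.mem_filter.1 ht').1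
    rw [planeTree_injective h] at hG'
    omega
  · exact fun n => (S n).measurableSet

lemma gwLaw_subset_infinite {p : ℝ} (hp : 1 / 2 < p) (hp1 : p ≤ 1) (F : BinaryTree Unit) :
    gwLaw p ({t | t.Infinite} ∩ {t | planeTree F ⊆ t}) =
      ENNReal.ofReal ((2 * p - 1) / p) * containProb p ⊤ F := by
  have hp0 : 0 ≤ p := by linarith
  have := isProbabilityMeasure_gwLaw hp0 hp1
  have h1 := measure_inter_add_sdiff (μ := gwLaw p) {t | planeTree F ⊆ t}
    (MeasurableSet.setOfPred_infinite (α := Vertex))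
  have h2 : {t : Set Vertex | planeTree F ⊆ t} \ {t | t.Infinite} =
      {t | planeTree F ⊆ t ∧ t.Finite} := by
    ext t
    simp
  have hfin : finiteContainProb p F ≠ ∞ := by
    rw [← gwLaw_subset_finite hp0 hp1]
    exact measure_ne_top _ _
  rw [h2, gwLaw_subset_finite hp0 hp1, gwLaw_subset hp0 hp1,
    ← containProb_top_add_finiteContainProb hp hp1] at h1
  rw [inter_comm]
  exact (ENNReal.add_left_inj hfin).1 h1

lemma gwLaw_infinite {p : ℝ} (hp : 1 / 2 < p) (hp1 : p ≤ 1) :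
    gwLaw p {t | t.Infinite} = ENNReal.ofReal ((2 * p - 1) / p) := by
  -- The empty binary tree encodes the root alone, which every plane tree contains.
  have h := gwLaw_subset_infinite hp hp1 .nil
  rw [containProb, mul_one] at h
  rw [← h]
  refine measure_congr ?_
  filter_upwards [ae_isPlaneTree_gwLaw p] with t ht
  refine propext ⟨fun h => ⟨h, ?_⟩, fun h => h.1⟩
  rintro v (rfl | hv)
  · exact ht.root_mem
  · exact absurd hv (by simp [place])

/-- A law of plane trees is determined by the probabilities of containing given finite trees. -/
lemma ext_of_planeTree_subset {μ ν : Measure (Set Vertex)} [IsProbabilityMeasure μ]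
    [IsProbabilityMeasure ν] (hμ : ∀ᵐ t ∂μ, IsPlaneTree t) (hν : ∀ᵐ t ∂ν, IsPlaneTree t)
    (h : ∀ F, μ {t | planeTree F ⊆ t} = ν {t | planeTree F ⊆ t}) : μ = ν := by
  classical
  let C : Set (Set (Set Vertex)) := range fun A : Finset Vertex => {t | ↑A ⊆ t}
  have hC : (Set.instMeasurableSpace : MeasurableSpace (Set Vertex)) =
      MeasurableSpace.generateFrom C := by
    apply le_antisymm
    · have hid : @Measurable _ _ (MeasurableSpace.generateFrom C) Set.instMeasurableSpace
          (id : Set Vertex → Set Vertex) := by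
        refine (@measurable_set_iff _ _ (MeasurableSpace.generateFrom C) _).2 fun v => ?_
        refine (@measurableSet_setOfPred _ (MeasurableSpace.generateFrom C) _).1 ?_
        exact MeasurableSpace.measurableSet_generateFrom ⟨{v}, by ext; simp⟩
      exact fun s hs => hid hs
    · refine MeasurableSpace.generateFrom_le ?_
      rintro _ ⟨A, rfl⟩
      exact measurableSet_setOf_subset _
  refine ext_of_generate_finite C hC ?_ ?_ (by simp)
  · rintro _ ⟨A, rfl⟩ _ ⟨B, rfl⟩ -
    refine ⟨A ∪ B, ?_⟩
    ext t
    simp [union_subset_iff]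
  · rintro _ ⟨A, rfl⟩
    -- A plane tree contains `A` exactly when it contains the tree generated by `A`, so the π-system
    -- reduces to the events in `h`.
    obtain ⟨F, hF⟩ := exists_planeTree_hull A
    have key : ∀ ρ : Measure (Set Vertex), (∀ᵐ t ∂ρ, IsPlaneTree t) →
        ρ {t | ↑A ⊆ t} = ρ {t | planeTree F ⊆ t} := fun ρ hρ => measure_congr <| by
      filter_upwards [hρ] with t ht
      exact propext (hF t ht)
    rw [key μ hμ, key ν hν, h]

lemma hasLaw_splitTree_top {p : ℝ} (hp : 1 / 2 < p) (hp1 : p ≤ 1) :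
    HasLaw (fun U => splitTree p U ⊤) ((gwLaw p)[|{t : Set Vertex | t.Infinite}]) labelLaw := by
  have hmeas := measurable_splitTree p ⊤
  have hθ : ENNReal.ofReal ((2 * p - 1) / p) ≠ 0 := by
    rw [Ne, ENNReal.ofReal_eq_zero, not_le]
    exact div_pos (by linarith) (by linarith)
  have := isProbabilityMeasure_gwLaw (by linarith) hp1
  have : IsProbabilityMeasure ((gwLaw p)[|{t : Set Vertex | t.Infinite}]) :=
    cond_isProbabilityMeasure (by rwa [gwLaw_infinite hp hp1])
  have := Measure.isProbabilityMeasure_map (μ := labelLaw) hmeas.aemeasurable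
  refine ⟨hmeas.aemeasurable, ext_of_planeTree_subset ?_ ?_ fun F => ?_⟩
  · exact (ae_map_iff hmeas.aemeasurable measurableSet_isPlaneTree).2
      (ae_of_all _ fun _ => isPlaneTree_splitTree)
  · exact cond_absolutelyContinuous.ae_le (ae_isPlaneTree_gwLaw p)
  · rw [Measure.map_apply hmeas (measurableSet_setOf_subset _),
      cond_apply MeasurableSet.setOfPred_infinite, gwLaw_subset_infinite hp hp1,
      gwLaw_infinite hp hp1, ← mul_assoc, ENNReal.inv_mul_cancel hθ ENNReal.ofReal_ne_top, one_mul,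
      ← labelLaw_planeTree_subset]
    rfl

/-! ### Existence of the limit at p = 1/2 and conclusion. -/

/-- The uniform plane trees can be coupled increasingly. -/
lemma exists_isIncreasingUnionLaw : ∃ μ : Measure (Set Vertex), IsIncreasingUnionLaw μ := by
  have hmeas : Measurable fun U => ⋃ n : ℕ, splitTree (1 / 2) U n := by
    refine measurable_set_of_forall_mem fun v => ?_
    simp only [mem_iUnion]
    have : {U | ∃ n : ℕ, v ∈ splitTree (1 / 2) U n} = ⋃ n : ℕ, {U | v ∈ splitTree (1 / 2) U n} := by
      ext; simp
    rw [this]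
    exact MeasurableSet.iUnion fun n => measurable_splitTree (1 / 2) n (measurableSet_mem v)
  -- For finite sizes the weights do not depend on p, so 1/2 serves only as an admissible value.
  refine ⟨labelLaw.map fun U => ⋃ n : ℕ, splitTree (1 / 2) U n, Vertex → ℝ, inferInstance, labelLaw,
    inferInstance, fun n U => splitTree (1 / 2) U n,
    fun n => hasLaw_splitTree (by norm_num) (by norm_num) n, ae_of_all _ fun U n => ?_,
    hmeas.aemeasurable, rfl⟩
  exact splitTree_mono (by norm_num) (by norm_num) (by exact_mod_cast Nat.le_succ n)

theorem corollary1p3 (k : ℕ) (hk : 1 ≤ k) (p : ℝ) (hp : 1 / 2 ≤ p) (hp1 : p ≤ 1) :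
    (∃ μ : Measure (Set Vertex), IsInfiniteTreeLaw p μ) ∧
    ∀ μ : Measure (Set Vertex), IsInfiniteTreeLaw p μ →
      ∃ (Ω : Type) (_ : MeasurableSpace Ω) (P : Measure Ω) (_ : IsProbabilityMeasure P)
        (S T : Ω → Set Vertex),
        HasLaw S (uniformTreeLaw k) P ∧ HasLaw T μ P ∧ ∀ᵐ ω ∂P, S ω ⊆ T ω := by
  obtain ⟨k, rfl⟩ := Nat.exists_eq_add_of_le' hk
  constructor
  · rcases hp.eq_or_lt with rfl | h
    · obtain ⟨μ, hμ⟩ := exists_isIncreasingUnionLaw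
      exact ⟨μ, .inl ⟨rfl, hμ⟩⟩
    · exact ⟨_, .inr ⟨h, rfl⟩⟩
  · rintro μ (⟨-, Ω, mΩ, P, hP, T, hT, -, hμ⟩ | ⟨h, rfl⟩)
    -- The coupling behind the limit law is reused: `T k` has k + 1 vertices, the size required
    -- after the shift of `k`, and is one of the sets united.
    · exact ⟨Ω, mΩ, P, hP, T k, fun ω => ⋃ n, T n ω, hT k, hμ,
        ae_of_all _ fun ω => subset_iUnion (fun n => T n ω) k⟩
    · exact ⟨Vertex → ℝ, inferInstance, labelLaw, inferInstance, fun U => splitTree p U k,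
        fun U => splitTree p U ⊤, hasLaw_splitTree (by linarith) hp1 k, hasLaw_splitTree_top h hp1,
        ae_of_all _ fun U => splitTree_mono (by linarith) hp1 le_top⟩
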